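/- Let $k\ge 0$, let $\mathbb R^{2k}=\mathbb R^k\times\mathbb R^k$ carry the standard symplectic form $\omega(u,v)=\langle Ju,v\rangle$, $J(x,y)=(-y,x)$, and let $H:\mathbb R\times\mathbb R^{2k}\to\mathbb R$ be such that each $H(t,\cdot)$ is $C^2$ and, for the Hamiltonian vector field $g(t,z)=J\nabla_zH(t,z)$, the derivative $D_zg$ is continuous on $\mathbb R\times\mathbb R^{2k}$. Let $z_-,z_+$ be rest points, $g(t,z_\pm)=0$ for all $t$, and let $x:\mathbb R\to\mathbb R^{2k}$ be a heteroclinic solution: $x'(t)=g(t,x(t))$ and $x(t)\to z_\pm$ as $t\to\pm\infty$. Let $S(t)=D_zg(t,x(t))$, and assume that the limits $S^\pm=\lim_{t\to\pm\infty}S(t)$ exist and are hyperbolic (no eigenvalue on the imaginary axis). For $\tau\in\mathbb R$ let $E^s(\tau)$ (resp. $E^u(\tau)$) be the space of values at time $\tau$ of the solutions of $u'=S(t)u$ with $u(t)\to0$ as $t\to+\infty$ (resp. $t\to-\infty$), and let $V^{-}(T)$, $V^{+}(T)$ denote the spectral subspaces of $T$ for the eigenvalues with negative, resp. positive, real part.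 Assume the transversality conditions $$V^+(S^-)+V^-(S^+)=\mathbb R^{2k},\qquad E^s(0)+E^u(0)=\mathbb R^{2k}.$$ Definitions. (i) Let $V,W$ be continuous paths of $k$-dimensional subspaces of $\mathbb R^{2k}$ on $[a,b]$, transversal at $a$ and $b$, with continuous frames $v_1,\dots,v_k$ and $w_1,\dots,w_k$, and let $M(t)=[v_1(t)|\cdots|v_k(t)|w_1(t)|\cdots|w_k(t)]$. The $\mathbb Z_2$-index $\iota(V,W;[a,b])$ is $0$ if $\det(M(a)M(b))>0$ and $1$ if $\det(M(a)M(b))<0$. (ii) Let $V,W$ be continuous paths of Lagrangian subspaces on $[a,b]$. Identify $(x,y)$ with $x+iy\in\mathbb C^k$ and write $V(t)=A(t)\mathbb R^k$, $W(t)=B(t)\mathbb R^k$ with continuous unitary matrices $A,B$; let $X=A^*B$ and $U=X^{T}X$, so that $\dim(V\cap W)$ is the multiplicity of the eigenvalue $1$ of $U$. The Maslov index $\iota^{CLM}(V,W;[a,b])$ is the net number of eigenvalues of $U(t)$ crossing $1$ counterclockwise, i.e. $\frac1{2\pi}$ times the total change over $[a,b]$ of $\varphi(t)-\sum_j\theta_j(t)$,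 where $\varphi$ is a continuous argument of $\det U$ and $e^{i\theta_j(t)}$, $\theta_j(t)\in(0,2\pi]$, are the eigenvalues of $U(t)$ with multiplicity. (iii) On $[0,\infty)$ both indices are defined as the index on $[0,T]$, for any $T>0$ such that $V(t)+W(t)=\mathbb R^{2k}$ for all $t\ge T$. The geometrical parity of $x$ is $\iota(x)=\iota(E^s(t),E^u(-t);[0,\infty))$ and the Maslov index of $x$ is $\iota^{CLM}(x)=\iota^{CLM}(E^s(t),E^u(-t);[0,\infty))$. Claim. Both $\iota(x)$ and $\iota^{CLM}(x)$ are defined (admissible $T$ and frames exist), and, for every admissible choice in their definitions, $$\iota(x)\equiv\iota^{CLM}(x)\pmod 2 .$$ -/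

import Mathlib

open Filter Topology

noncomputable section

/-! ## Spectral subspaces and hyperbolicity of a real linear operator -/

section Spectral

variable {E : Type*} [AddCommGroup E] [Module ℝ E]

/-- `T` is hyperbolic: its complexification has no eigenvalue on the imaginary axis. -/
def IsHyperbolic (T : E →ₗ[ℝ] E) : Prop :=
  ∀ μ : ℂ, Module.End.HasEigenvalue (T.baseChange ℂ) μ → μ.re ≠ 0

/-- The real part of the sum of the generalized eigenspaces of the complexification of `T`
for the eigenvalues in the set `s`, where `v : E` is identified with `1 ⊗ v`. -/
def spectralSubspace (T : E →ₗ[ℝ] E) (s : Set ℂ) : Submodule ℝ E :=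
  ((⨆ μ ∈ s, Module.End.maxGenEigenspace (T.baseChange ℂ) μ).restrictScalars ℝ).comap
    (TensorProduct.mk ℝ ℂ E 1)

/-- The negative spectral subspace `V⁻(T)`. -/
def negSpectralSubspace (T : E →ₗ[ℝ] E) : Submodule ℝ E :=
  spectralSubspace T {μ | μ.re < 0}

/-- The positive spectral subspace `V⁺(T)`. -/
def posSpectralSubspace (T : E →ₗ[ℝ] E) : Submodule ℝ E :=
  spectralSubspace T {μ | 0 < μ.re}

end Spectral

/-- Transversality of two linear subspaces: their sum is the whole space. -/
def Transversal {E : Type*} [AddCommGroup E] [Module ℝ E] (V W : Submodule ℝ E) : Prop :=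
  V ⊔ W = ⊤

/-! ## Stable and unstable subspaces of a linear system `u' = S(t) u` -/

section LinearSystem

variable {E : Type*} [NormedAddCommGroup E] [NormedSpace ℝ E]

/-- `u` solves `u'(t) = S(t) u(t)` on the whole line. -/
def IsLinearSolution (S : ℝ → E →L[ℝ] E) (u : ℝ → E) : Prop :=
  ∀ t, HasDerivAt u (S t (u t)) t

/-- The initial values at time `τ` of the solutions of `u' = S(t) u` that tend to `0` along `l`.
(The solution with value `v` at time `τ` is `t ↦ γ_τ(t) v`, with `γ_τ` the fundamental matrix
normalised by `γ_τ(τ) = I`.) -/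
def decayingSubspace (S : ℝ → E →L[ℝ] E) (l : Filter ℝ) (τ : ℝ) : Submodule ℝ E where
  carrier := {v | ∃ u : ℝ → E, IsLinearSolution S u ∧ u τ = v ∧ Tendsto u l (𝓝 0)}
  zero_mem' := by
    refine ⟨fun _ => 0, fun t => ?_, rfl, tendsto_const_nhds⟩
    simpa using hasDerivAt_const t (0 : E)
  add_mem' := by
    rintro _ _ ⟨u, hu, rfl, hu0⟩ ⟨w, hw, rfl, hw0⟩
    refine ⟨fun t => u t + w t, fun t => ?_, rfl, by simpa using hu0.add hw0⟩
    rw [map_add]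
    exact (hu t).add (hw t)
  smul_mem' := by
    rintro c _ ⟨u, hu, rfl, hu0⟩
    refine ⟨fun t => c • u t, fun t => ?_, rfl, by simpa using hu0.const_smul c⟩
    rw [map_smul]
    exact (hu t).const_smul c

/-- The stable subspace `E^s(τ)`. -/
def stableSubspace (S : ℝ → E →L[ℝ] E) (τ : ℝ) : Submodule ℝ E :=
  decayingSubspace S atTop τ

/-- The unstable subspace `E^u(τ)`. -/
def unstableSubspace (S : ℝ → E →L[ℝ] E) (τ : ℝ) : Submodule ℝ E :=
  decayingSubspace S atBot τ

end LinearSystem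

/-! ## The `ℤ₂`-index of a pair of paths of subspaces of `ℝ^(p+q)` of dimensions `p` and `q` -/

section Z2Index

variable {p q : ℕ}

/-- The square matrix whose columns are the coordinates of `v₁, …, v_p, w₁, …, w_q`. -/
def frameMatrix (v : Fin p → EuclideanSpace ℝ (Fin p ⊕ Fin q))
    (w : Fin q → EuclideanSpace ℝ (Fin p ⊕ Fin q)) : Matrix (Fin p ⊕ Fin q) (Fin p ⊕ Fin q) ℝ :=
  Matrix.of fun i j => Sum.elim v w j i

/-- `v` is a continuous frame of the path of `m`-dimensional subspaces `V` on `[a, b]`. -/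
structure IsContinuousFrame {E : Type*} [NormedAddCommGroup E] [NormedSpace ℝ E] {m : ℕ}
    (V : ℝ → Submodule ℝ E) (a b : ℝ) (v : ℝ → Fin m → E) : Prop where
  continuousOn : ContinuousOn v (Set.Icc a b)
  linearIndependent : ∀ t ∈ Set.Icc a b, LinearIndependent ℝ (v t)
  span_eq : ∀ t ∈ Set.Icc a b, Submodule.span ℝ (Set.range (v t)) = V t

/-- `i` is the `ℤ₂`-index of the pair `(V, W)` of continuous paths of subspaces on `[a, b]`
(of dimensions `p` and `q`, transversal at `a` and at `b`): with `M(t)` the matrix of continuous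
frames of `V` and `W`, it is `0` if `det (M(a) M(b)) > 0` and `1` if `det (M(a) M(b)) < 0`. -/
def IsZ2Index (V W : ℝ → Submodule ℝ (EuclideanSpace ℝ (Fin p ⊕ Fin q))) (a b : ℝ) (i : ℤ) :
    Prop :=
  ∃ (v : ℝ → Fin p → EuclideanSpace ℝ (Fin p ⊕ Fin q))
    (w : ℝ → Fin q → EuclideanSpace ℝ (Fin p ⊕ Fin q)),
    IsContinuousFrame V a b v ∧ IsContinuousFrame W a b w ∧
    ((0 < (frameMatrix (v a) (w a) * frameMatrix (v b) (w b)).det ∧ i = 0) ∨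
      ((frameMatrix (v a) (w a) * frameMatrix (v b) (w b)).det < 0 ∧ i = 1))

/-- The `ℤ₂`-index on `[a, ∞)`: the index on `[a, T]`, where `V(t)` and `W(t)` are transversal for
all `t ≥ T`. -/
def IsZ2IndexOnIci (V W : ℝ → Submodule ℝ (EuclideanSpace ℝ (Fin p ⊕ Fin q))) (a : ℝ) (i : ℤ) :
    Prop :=
  ∃ T, a < T ∧ (∀ t, T ≤ t → Transversal (V t) (W t)) ∧ IsZ2Index V W a T i

/-- `i` is the geometrical parity `ι(S)` of the linear path `S`: the `ℤ₂`-index of the pair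
`(E^s(t), E^u(-t))`, `t ∈ [0, ∞)`. -/
def IsGeometricalParity
    (S : ℝ → EuclideanSpace ℝ (Fin p ⊕ Fin q) →L[ℝ] EuclideanSpace ℝ (Fin p ⊕ Fin q)) (i : ℤ) :
    Prop :=
  IsZ2IndexOnIci (stableSubspace S) (fun t => unstableSubspace S (-t)) 0 i

end Z2Index

/-! ## The Maslov index of a pair of paths of Lagrangian subspaces -/

/-- The standard symplectic space `ℝ^{2k} = ℝ^k × ℝ^k`. The matrix `Matrix.J (Fin k) ℝ` is
`J (x, y) = (-y, x)`, the symplectic form is `ω(u, v) = ⟨J u, v⟩`. -/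
abbrev PhaseSpace (k : ℕ) : Type := EuclideanSpace ℝ (Fin k ⊕ Fin k)

section Maslov

variable {k : ℕ}

/-- The Lagrangian subspace `A ℝ^k` of `ℝ^{2k} = ℂ^k`, where `(x, y)` is identified with `x + i y`
(so that `J` is the multiplication by `i`). When `A` runs through the unitary matrices, these are
exactly the Lagrangian subspaces of `(ℝ^{2k}, ω)`. -/
def lagrangianOf (A : Matrix (Fin k) (Fin k) ℂ) : Submodule ℝ (PhaseSpace k) :=
  Submodule.span ℝ (Set.range fun j : Fin k =>
    WithLp.toLp 2 (Sum.elim (fun i => (A i j).re) (fun i => (A i j).im)))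

/-- For Lagrangian subspaces `V = A ℝ^k` and `W = B ℝ^k` (`A`, `B` unitary), the unitary matrix
`U = Xᵀ X` with `X = A⁻¹ B = A* B`. Up to conjugation by an orthogonal matrix it depends on `V` and
`W` only, and `dim (V ∩ W)` is the multiplicity of the eigenvalue `1` of `U`. -/
def souriauMatrix (A B : Matrix (Fin k) (Fin k) ℂ) : Matrix (Fin k) (Fin k) ℂ :=
  (A.conjTranspose * B).transpose * (A.conjTranspose * B)

/-- The sum of the angles `θ_j ∈ (0, 2π]` of the eigenvalues `e^{iθ_j}` of a unitary matrix, counted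
with multiplicity. -/
def angleSum (U : Matrix (Fin k) (Fin k) ℂ) : ℝ :=
  (U.charpoly.roots.map fun z => toIocMod Real.two_pi_pos 0 z.arg).sum

/-- `m` is the Maslov index of the pair `(V, W)` of continuous paths of Lagrangian subspaces on
`[a, b]`: the net number of eigenvalues of the unitary matrix `U(t)` associated with the pair that
cross `1` counterclockwise. With a continuous argument `φ` of `det U`, the quantity
`φ(t) - ∑ θ_j(t)`, `θ_j(t) ∈ (0, 2π]`, takes values in `2πℤ` and changes exactly when an eigenvalue
of `U(t)` reaches or leaves `1`, by `2π` for each eigenvalue that crosses `1` counterclockwise; hence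
the number of crossings is its total change divided by `2π`. The choice of the half-open interval
`(0, 2π]` gives index `1` to `(ℝ, e^{it}ℝ)` on `[-π/4, π/4]` and on `[0, π/4]`, and `0` on
`[-π/4, 0]`. -/
def IsMaslovIndex (V W : ℝ → Submodule ℝ (PhaseSpace k)) (a b : ℝ) (m : ℤ) : Prop :=
  ∃ (A B : ℝ → Matrix (Fin k) (Fin k) ℂ) (φ : ℝ → ℝ),
    ContinuousOn A (Set.Icc a b) ∧ ContinuousOn B (Set.Icc a b) ∧ ContinuousOn φ (Set.Icc a b) ∧
    (∀ t ∈ Set.Icc a b,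
      A t ∈ Matrix.unitaryGroup (Fin k) ℂ ∧ B t ∈ Matrix.unitaryGroup (Fin k) ℂ ∧
      lagrangianOf (A t) = V t ∧ lagrangianOf (B t) = W t ∧
      (souriauMatrix (A t) (B t)).det = Complex.exp (φ t * Complex.I)) ∧
    (φ b - angleSum (souriauMatrix (A b) (B b))) - (φ a - angleSum (souriauMatrix (A a) (B a)))
      = 2 * Real.pi * m

/-- The Maslov index on `[a, ∞)`: the index on `[a, T]`, where `V(t)` and `W(t)` are transversal for
all `t ≥ T`. -/
def IsMaslovIndexOnIci (V W : ℝ → Submodule ℝ (PhaseSpace k)) (a : ℝ) (m : ℤ) : Prop :=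
  ∃ T, a < T ∧ (∀ t, T ≤ t → Transversal (V t) (W t)) ∧ IsMaslovIndex V W a T m

/-- `m` is the Maslov index of the linear Hamiltonian path `S`: the Maslov index of the pair
`(E^s(t), E^u(-t))`, `t ∈ [0, ∞)`. -/
def IsMaslovIndexOfPath (S : ℝ → PhaseSpace k →L[ℝ] PhaseSpace k) (m : ℤ) : Prop :=
  IsMaslovIndexOnIci (stableSubspace S) (fun t => unstableSubspace S (-t)) 0 m

end Maslov

/-! ## Nonautonomous Hamiltonian vector fields -/

section Hamiltonian

variable {k : ℕ}

/-- The nonautonomous Hamiltonian vector field `g(t, z) = J ∇H(t, z)`. -/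
def hamiltonianField (H : ℝ → PhaseSpace k → ℝ) (t : ℝ) (z : PhaseSpace k) : PhaseSpace k :=
  Matrix.toEuclideanLin (Matrix.J (Fin k) ℝ) (gradient (H t) z)

/-- The point `z` is a rest point of the nonautonomous vector field `g`. -/
def IsRestPoint {E : Type*} [Zero E] (g : ℝ → E → E) (z : E) : Prop :=
  ∀ t, g t z = 0

/-- `x` is a heteroclinic solution of `x' = g(t, x)` from `zm` to `zp`. -/
structure IsHeteroclinic {E : Type*} [NormedAddCommGroup E] [NormedSpace ℝ E]
    (g : ℝ → E → E) (zm zp : E) (x : ℝ → E) : Prop where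
  hasDerivAt : ∀ t, HasDerivAt x (g t (x t)) t
  tendsto_atBot : Tendsto x atBot (𝓝 zm)
  tendsto_atTop : Tendsto x atTop (𝓝 zp)

/-- The path `S(t) = D_z g(t, x(t))` obtained by linearizing `g` along `x`. -/
def linearizationAlong {E : Type*} [NormedAddCommGroup E] [NormedSpace ℝ E]
    (g : ℝ → E → E) (x : ℝ → E) (t : ℝ) : E →L[ℝ] E :=
  fderiv ℝ (g t) (x t)

end Hamiltonian

end

/-! Both indices are read off from the determinant of the frame matrix `M` at the two ends of the
interval. Let `A`, `B` be unitary frames, `X = A* B` and `U = Xᵀ X`. Then `(-2i)^k det M = conj (det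
X) · det (1 - U)` (`neg_two_I_pow_mul_frameMatrix_det`). An eigenvalue `e^{iθ}` of `U` contributes
`1 - e^{iθ} = -2i e^{iθ/2} sin (θ/2)`, and `sin (θ/2) ≥ 0` for `θ ∈ (0, 2π]`. Hence `det M = conj
(det X) · e^{i ∑ θ_j / 2} · r` with `r ≥ 0`.

Since `(det X)² = det U = e^{iφ}`, the function `ε = conj (det X) · e^{iφ/2}` is continuous with `ε²
= 1`, so it is constant. Thus `det M = ε e^{-i(φ - ∑ θ_j)/2} r`. A total change `2πm` of `φ - ∑ θ_j`
therefore gives `det M(a) · det M(b) = (-1)^m` times a nonnegative number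
(`exists_neg_one_zpow_mul`). Another choice of continuous frames multiplies this product by a
positive number, and transversality makes it nonzero, so its sign is both the `ℤ₂`-index and the
parity of `m` (`IsZ2IndexOnIci.modEq`).

For existence, `ω` is constant along pairs of solutions, so spaces of decaying solutions are
isotropic (`isIsotropic_decayingSubspace`). Transversality at time `0` then forces both dimensions
to be `k`. The flow transports bases to global frames, and Gram–Schmidt makes these unitary.
Admissible `T` come from `exists_forall_transversal`: quadratic Lyapunov forms of `S^±` show that
limits of unit vectors of `E^s(t)`, `E^u(-t)` lie in `V^-(S^+)`, `V^+(S^-)`, which meet only in `0`.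
-/

noncomputable section

/-! ## The standard symplectic form -/

section Symplectic

variable {k : ℕ}

/-- The standard symplectic form `ω(u, v) = ⟨J u, v⟩` of `ℝ^{2k}`. -/
def symplecticForm (k : ℕ) : LinearMap.BilinForm ℝ (PhaseSpace k) :=
  (innerₗ (PhaseSpace k)) ∘ₗ (Matrix.toEuclideanLin (Matrix.J (Fin k) ℝ))

theorem symplecticForm_apply (u v : PhaseSpace k) :
    symplecticForm k u v = inner ℝ (Matrix.toEuclideanLin (Matrix.J (Fin k) ℝ) u) v := rfl

theorem toEuclideanLin_J_inl (u : PhaseSpace k) (i : Fin k) :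
    Matrix.toEuclideanLin (Matrix.J (Fin k) ℝ) u (Sum.inl i) = - u (Sum.inr i) := by
  simp [Matrix.toLpLin_apply, Matrix.J, Matrix.mulVec, dotProduct, Matrix.one_apply]

theorem toEuclideanLin_J_inr (u : PhaseSpace k) (i : Fin k) :
    Matrix.toEuclideanLin (Matrix.J (Fin k) ℝ) u (Sum.inr i) = u (Sum.inl i) := by
  simp [Matrix.toLpLin_apply, Matrix.J, Matrix.mulVec, dotProduct, Matrix.one_apply]

theorem symplecticForm_eq_sum (u v : PhaseSpace k) :
    symplecticForm k u v = ∑ i : Fin k, (u (Sum.inl i) * v (Sum.inr i)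
      - u (Sum.inr i) * v (Sum.inl i)) := by
  rw [symplecticForm_apply, PiLp.inner_apply]
  simp only [Fintype.sum_sum_type, toEuclideanLin_J_inl, toEuclideanLin_J_inr,
    ← Finset.sum_add_distrib]
  refine Finset.sum_congr rfl fun i _ => ?_
  simp
  ring

theorem toEuclideanLin_J_J (u : PhaseSpace k) :
    Matrix.toEuclideanLin (Matrix.J (Fin k) ℝ) (Matrix.toEuclideanLin (Matrix.J (Fin k) ℝ) u)
      = -u := by
  ext i
  rcases i with i | i <;> simp only [toEuclideanLin_J_inl, toEuclideanLin_J_inr, PiLp.neg_apply]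

theorem continuous_symplecticForm {X : Type*} [TopologicalSpace X] {f g : X → PhaseSpace k}
    (hf : Continuous f) (hg : Continuous g) : Continuous fun x => symplecticForm k (f x) (g x) := by
  simp only [symplecticForm_eq_sum]
  fun_prop

theorem inner_toEuclideanLin_J (u v : PhaseSpace k) :
    inner ℝ u (Matrix.toEuclideanLin (Matrix.J (Fin k) ℝ) v) =
      - inner ℝ (Matrix.toEuclideanLin (Matrix.J (Fin k) ℝ) u) v := by
  rw [PiLp.inner_apply, PiLp.inner_apply]
  simp only [Fintype.sum_sum_type, toEuclideanLin_J_inl, toEuclideanLin_J_inr,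
    ← Finset.sum_add_distrib, ← Finset.sum_neg_distrib]
  refine Finset.sum_congr rfl fun i _ => ?_
  simp

/-- `S` belongs to the symplectic Lie algebra. -/
def IsInfinitesimallySymplectic (S : PhaseSpace k →ₗ[ℝ] PhaseSpace k) : Prop :=
  ∀ x y, symplecticForm k (S x) y + symplecticForm k x (S y) = 0

/-- A subspace on which the symplectic form vanishes. -/
def IsIsotropic (V : Submodule ℝ (PhaseSpace k)) : Prop :=
  ∀ x ∈ V, ∀ y ∈ V, symplecticForm k x y = 0

/-- The injective map `J` sends an isotropic `V` into `Vᗮ`, so `dim V ≤ 2k - dim V`. -/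
theorem IsIsotropic.finrank_le {V : Submodule ℝ (PhaseSpace k)} (hV : IsIsotropic V) :
    Module.finrank ℝ V ≤ k := by
  have hinj : Function.Injective (Matrix.toEuclideanLin (Matrix.J (Fin k) ℝ)) := by
    intro u v h
    have := congrArg (Matrix.toEuclideanLin (Matrix.J (Fin k) ℝ)) h
    simpa [toEuclideanLin_J_J] using this
  have hle : V.map (Matrix.toEuclideanLin (Matrix.J (Fin k) ℝ)) ≤ Vᗮ := by
    rintro _ ⟨x, hx, rfl⟩
    rw [Submodule.mem_orthogonal]
    intro y hy
    rw [real_inner_comm]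
    exact hV x hx y hy
  have h1 := Submodule.finrank_mono hle
  rw [(Submodule.equivMapOfInjective _ hinj V).symm.finrank_eq] at h1
  have h2 : Module.finrank ℝ V + Module.finrank ℝ Vᗮ = k + k :=
    V.finrank_add_finrank_orthogonal.trans (by simp [finrank_euclideanSpace])
  have h1' : Module.finrank ℝ V ≤ Module.finrank ℝ Vᗮ := h1
  omega

/-- The derivative of a Hamiltonian vector field is infinitesimally symplectic. -/
theorem isInfinitesimallySymplectic_fderiv_hamiltonianField {H : ℝ → PhaseSpace k → ℝ} {t : ℝ}
    (hH : ContDiff ℝ 2 (H t)) (z : PhaseSpace k) :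
    IsInfinitesimallySymplectic
      (fderiv ℝ (hamiltonianField H t) z : PhaseSpace k →ₗ[ℝ] PhaseSpace k) := by
  have hsymm : IsSymmSndFDerivAt ℝ (H t) z := hH.contDiffAt.isSymmSndFDerivAt (by simp)
  have hd : DifferentiableAt ℝ (fderiv ℝ (H t)) z :=
    ((hH.fderiv_right (m := 1) (by norm_num)).differentiable (by norm_num)) z
  -- `L` is the inverse Riesz map, so that the field is `J' ∘ L ∘ DH` and the chain rule gives its
  -- derivative `J · Hess H`. The claim then reduces to the symmetry of the second derivative.
  set L : StrongDual ℝ (PhaseSpace k) →L[ℝ] PhaseSpace k :=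
    LinearMap.toContinuousLinearMap
      { toFun := (InnerProductSpace.toDual ℝ (PhaseSpace k)).symm
        map_add' := map_add _
        map_smul' := fun c x => by simp } with hL
  set J' : PhaseSpace k →L[ℝ] PhaseSpace k :=
    LinearMap.toContinuousLinearMap (Matrix.toEuclideanLin (Matrix.J (Fin k) ℝ)) with hJ'
  have hfun : hamiltonianField H t = fun z => J' (L (fderiv ℝ (H t) z)) := rfl
  have hfd : fderiv ℝ (hamiltonianField H t) z = J' ∘L L ∘L fderiv ℝ (fderiv ℝ (H t)) z := by
    rw [hfun]
    exact (J'.hasFDerivAt.comp z (L.hasFDerivAt.comp z hd.hasFDerivAt)).fderiv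
  have key : ∀ v w, inner ℝ (L (fderiv ℝ (fderiv ℝ (H t)) z v)) w
      = fderiv ℝ (fderiv ℝ (H t)) z v w := fun v w =>
    InnerProductSpace.toDual_symm_apply
  intro x y
  rw [hfd]
  simp only [symplecticForm_apply]
  have e1 : ∀ x, (↑(J' ∘L L ∘L fderiv ℝ (fderiv ℝ (H t)) z) : PhaseSpace k →ₗ[ℝ] PhaseSpace k) x
    = Matrix.toEuclideanLin (Matrix.J (Fin k) ℝ) (L (fderiv ℝ (fderiv ℝ (H t)) z x)) := fun _ => rfl
  rw [e1, e1, toEuclideanLin_J_J, inner_toEuclideanLin_J, toEuclideanLin_J_J, inner_neg_left,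
    inner_neg_left, neg_neg, key, real_inner_comm, key, hsymm.eq x y]
  ring

theorem IsInfinitesimallySymplectic.of_tendsto {ι : Type*} {l : Filter ι} [l.NeBot]
    {S : ι → PhaseSpace k →L[ℝ] PhaseSpace k} {T : PhaseSpace k →L[ℝ] PhaseSpace k}
    (hS : ∀ t, IsInfinitesimallySymplectic (S t : PhaseSpace k →ₗ[ℝ] PhaseSpace k))
    (h : Tendsto S l (𝓝 T)) :
    IsInfinitesimallySymplectic (T : PhaseSpace k →ₗ[ℝ] PhaseSpace k) := by
  intro x y
  have hc : Continuous fun A : PhaseSpace k →L[ℝ] PhaseSpace k =>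
      symplecticForm k (A x) y + symplecticForm k x (A y) :=
    (continuous_symplecticForm (by fun_prop) continuous_const).add
      (continuous_symplecticForm continuous_const (by fun_prop))
  have h1 := (hc.tendsto T).comp h
  refine tendsto_nhds_unique h1 ?_
  refine tendsto_const_nhds.congr fun t => ?_
  exact (hS t x y).symm

end Symplectic

/-! ## Decaying solutions of linear systems -/

section LinearODE

variable {E : Type*} [NormedAddCommGroup E] [NormedSpace ℝ E]

theorem IsLinearSolution.continuous {S : ℝ → E →L[ℝ] E} {u : ℝ → E} (hu : IsLinearSolution S u) :
    Continuous u :=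
  continuous_iff_continuousAt.2 fun t => (hu t).continuousAt

/-- Uniqueness of solutions of `u' = S(t) u` for continuous `S`. -/
theorem IsLinearSolution.eq_of_eq_at {S : ℝ → E →L[ℝ] E} (hS : Continuous S) {u w : ℝ → E}
    (hu : IsLinearSolution S u) (hw : IsLinearSolution S w) {t₀ : ℝ} (h : u t₀ = w t₀) : u = w := by
  funext t
  obtain ⟨R, hR⟩ : ∃ R, R > |t| ∧ R > |t₀| :=
    ⟨max |t| |t₀| + 1, by linarith [le_max_left |t| |t₀|], by linarith [le_max_right |t| |t₀|]⟩
  obtain ⟨C, hC⟩ := (isCompact_Icc (a := -R) (b := R)).exists_bound_of_continuousOn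
    hS.continuousOn
  have ht := abs_lt.1 hR.1
  have ht₀ := abs_lt.1 hR.2
  refine ODE_solution_unique_of_mem_Ioo (v := fun t x => S t x) (s := fun _ => Set.univ)
    (K := C.toNNReal) (a := -R) (b := R) (t₀ := t₀) ?_ ⟨ht₀.1, ht₀.2⟩
    (fun s _ => ⟨hu s, trivial⟩) (fun s _ => ⟨hw s, trivial⟩) h ⟨ht.1, ht.2⟩
  intro s hs
  refine LipschitzWith.lipschitzOnWith ?_
  refine (S s).lipschitz.weaken ?_
  rw [← NNReal.coe_le_coe, coe_nnnorm]
  exact (hC s ⟨hs.1.le, hs.2.le⟩).trans (Real.le_coe_toNNReal C)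

theorem isLinearSolution_sum {S : ℝ → E →L[ℝ] E} {ι : Type*} [Fintype ι] {u : ι → ℝ → E}
    (hu : ∀ i, IsLinearSolution S (u i)) (c : ι → ℝ) :
    IsLinearSolution S fun t => ∑ i, c i • u i t := by
  intro t
  rw [map_sum]
  refine HasDerivAt.fun_sum fun i _ => ?_
  rw [map_smul]
  exact (hu i t).const_smul (c i)

theorem isLinearSolution_zero (S : ℝ → E →L[ℝ] E) : IsLinearSolution S fun _ => 0 := fun t => by
  simpa using hasDerivAt_const t (0 : E)

/-- The bundle of initial values of decaying solutions has a global continuous frame. -/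
theorem exists_frame_decayingSubspace {S : ℝ → E →L[ℝ] E} (hS : Continuous S) {l : Filter ℝ}
    {m : ℕ} {τ₀ : ℝ} [FiniteDimensional ℝ E]
    (hm : Module.finrank ℝ (decayingSubspace S l τ₀) = m) :
    ∃ v : ℝ → Fin m → E, Continuous v ∧ (∀ t, LinearIndependent ℝ (v t)) ∧
      ∀ t, Submodule.span ℝ (Set.range (v t)) = decayingSubspace S l t := by
  -- The frame consists of the decaying solutions through a basis at time `τ₀`. By uniqueness, a
  -- linear relation that holds at one time holds at all times.
  let b := Module.finBasisOfFinrankEq ℝ (decayingSubspace S l τ₀) hm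
  choose u hu hu0 hul using fun j => (b j).2
  refine ⟨fun t j => u j t, continuous_pi fun j => (hu j).continuous, fun t => ?_, fun t => ?_⟩
  · rw [Fintype.linearIndependent_iff]
    intro c hc
    have h0 : (fun t => ∑ i, c i • u i t) = fun _ => 0 :=
      (isLinearSolution_sum hu c).eq_of_eq_at hS (isLinearSolution_zero S) (t₀ := t) hc
    have h1 : ∑ i, c i • (b i) = 0 := by
      apply Subtype.ext
      have := congrFun h0 τ₀
      simpa [hu0] using this
    exact Fintype.linearIndependent_iff.1 b.linearIndependent c h1
  · apply le_antisymm
    · rw [Submodule.span_le]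
      rintro _ ⟨j, rfl⟩
      exact ⟨u j, hu j, rfl, hul j⟩
    · rintro x ⟨w, hw, rfl, hwl⟩
      have hmem : w τ₀ ∈ decayingSubspace S l τ₀ := ⟨w, hw, rfl, hwl⟩
      have hsum := b.sum_repr ⟨w τ₀, hmem⟩
      have hEq : w = fun t => ∑ i, b.repr ⟨w τ₀, hmem⟩ i • u i t := by
        refine hw.eq_of_eq_at hS (isLinearSolution_sum hu _) (t₀ := τ₀) ?_
        refine (congrArg Subtype.val hsum).symm.trans ?_
        simp only [hu0, AddSubmonoidClass.coe_finsetSum, Submodule.coe_smul]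
      rw [hEq]
      exact Submodule.sum_mem _ fun i _ =>
        Submodule.smul_mem _ _ (Submodule.subset_span ⟨i, rfl⟩)

/-- Time reversal `u ↦ u(-·)` exchanges the two ends of the line, so the asymptotic analysis is
needed at `+∞` only. -/
theorem decayingSubspace_comp_neg (S : ℝ → E →L[ℝ] E) (t : ℝ) :
    unstableSubspace S (-t) = stableSubspace (fun s => -S (-s)) t := by
  ext v
  constructor
  · rintro ⟨u, hu, rfl, hul⟩
    refine ⟨fun s => u (-s), fun s => ?_, rfl, hul.comp tendsto_neg_atTop_atBot⟩
    simpa [Function.comp_def] using (hu (-s)).scomp s (hasDerivAt_neg s)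
  · rintro ⟨u, hu, rfl, hul⟩
    refine ⟨fun s => u (-s), fun s => ?_, by simp, hul.comp tendsto_neg_atBot_atTop⟩
    simpa [Function.comp_def] using (hu (-s)).scomp s (hasDerivAt_neg s)

end LinearODE

theorem HasDerivAt.bilin {E : Type*} [NormedAddCommGroup E] [NormedSpace ℝ E]
    [FiniteDimensional ℝ E] (B : LinearMap.BilinForm ℝ E) {u w : ℝ → E} {u' w' : E} {t : ℝ}
    (hu : HasDerivAt u u' t) (hw : HasDerivAt w w' t) :
    HasDerivAt (fun t => B (u t) (w t)) (B u' (w t) + B (u t) w') t := by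
  have h := ((LinearMap.toContinuousBilinearMap B).hasFDerivAt_of_bilinear
    hu.hasFDerivAt hw.hasFDerivAt).hasDerivAt
  simpa [add_comm] using h

/-- Along two solutions `ω(u, w)` has derivative `0`, and its constant value equals its limit `ω(0,
0) = 0`. -/
theorem isIsotropic_decayingSubspace {k : ℕ} {S : ℝ → PhaseSpace k →L[ℝ] PhaseSpace k}
    (hS : ∀ t, IsInfinitesimallySymplectic (S t : PhaseSpace k →ₗ[ℝ] PhaseSpace k))
    (l : Filter ℝ) [l.NeBot] (τ : ℝ) : IsIsotropic (decayingSubspace S l τ) := by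
  rintro _ ⟨u, hu, rfl, hul⟩ _ ⟨w, hw, rfl, hwl⟩
  have hd : ∀ t, HasDerivAt (fun t => symplecticForm k (u t) (w t)) 0 t := fun t => by
    have := HasDerivAt.bilin (symplecticForm k) (hu t) (hw t)
    rwa [show symplecticForm k (S t (u t)) (w t) + symplecticForm k (u t) (S t (w t)) = 0 from
      hS t (u t) (w t)] at this
  have hconst : ∀ t, symplecticForm k (u t) (w t) = symplecticForm k (u τ) (w τ) := fun t =>
    is_const_of_deriv_eq_zero (fun t => (hd t).differentiableAt) (fun t => (hd t).deriv) t τ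
  have hc : Continuous fun p : PhaseSpace k × PhaseSpace k => symplecticForm k p.1 p.2 :=
    continuous_symplecticForm continuous_fst continuous_snd
  have h0 := (hc.tendsto (0, 0)).comp (hul.prodMk_nhds hwl)
  simp only [map_zero] at h0
  exact tendsto_nhds_unique (tendsto_const_nhds.congr fun t => (hconst t).symm) h0

/-! ## Lyapunov forms of a hyperbolic operator -/

section SpectralResolution

variable {V : Type*} [AddCommGroup V] [Module ℂ V] [FiniteDimensional ℂ V]

/-- The identity is a sum of operators that commute with `T` and map into the generalized
eigenspaces of `T`. -/
theorem exists_spectral_resolution (T : Module.End ℂ V) :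
    ∃ (t : Finset ℂ) (n : ℕ) (P : ℂ → Module.End ℂ V),
      (∀ μ ∈ t, T.HasEigenvalue μ) ∧ (∀ μ ∈ t, (T - μ • 1) ^ n * P μ = 0) ∧
      (∀ μ, Commute T (P μ)) ∧ ∑ μ ∈ t, P μ = 1 := by
  classical
  set p := T.charpoly with hp
  set t := p.roots.toFinset with ht
  set s : ℂ → Polynomial ℂ := fun μ => (Polynomial.X - Polynomial.C μ) ^ p.roots.count μ with hs
  have hprod : p = ∏ μ ∈ t, s μ := by
    have h1 := (IsAlgClosed.splits p).eq_prod_roots_of_monic T.charpoly_monic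
    rw [h1, Finset.prod_multiset_map_count]
  have hCH : Polynomial.aeval T p = 0 := LinearMap.aeval_self_charpoly T
  have heig : ∀ μ ∈ t, T.HasEigenvalue μ := fun μ hμ => by
    rw [Module.End.hasEigenvalue_iff_isRoot_charpoly]
    exact (Polynomial.mem_roots'.1 (Multiset.mem_toFinset.1 hμ)).2
  -- Without eigenvalues the characteristic polynomial is `1`, and Cayley–Hamilton gives `1 = 0`:
  -- the space is trivial. The Bézout identity below needs a nonempty index set.
  rcases t.eq_empty_or_nonempty with h0 | hne
  · refine ⟨∅, 0, fun _ => 0, by simp, by simp, fun μ => Commute.zero_right T, ?_⟩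
    rw [h0, Finset.prod_empty] at hprod
    rw [hprod] at hCH
    simpa using hCH.symm
  -- Bézout for the pairwise coprime factors `(X - μ)^{m_μ}` of `p`: `1 = ∑ r_μ ∏_{j ≠ μ} s_j`.
  -- Evaluated at `T`, the summands are the required operators. The degree of `p` bounds all
  -- multiplicities and serves as the common exponent.
  obtain ⟨r, hr⟩ := (exists_sum_eq_one_iff_pairwise_coprime (s := s) hne).2 (by
    intro i j hij
    exact (Polynomial.isCoprime_X_sub_C_of_isUnit_sub
      (sub_ne_zero.2 (fun h => hij (Subtype.ext h))).isUnit).pow)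
  refine ⟨t, p.natDegree, fun μ => Polynomial.aeval T (r μ * ∏ j ∈ t \ {μ}, s j), heig, ?_, ?_, ?_⟩
  · intro μ hμ
    have h1 : T - μ • 1 = Polynomial.aeval T (Polynomial.X - Polynomial.C μ) := by
      simp [Algebra.algebraMap_eq_smul_one]
    have hle : p.roots.count μ ≤ p.natDegree :=
      (Multiset.count_le_card _ _).trans (Polynomial.card_roots' p)
    have hdvd : p ∣ (Polynomial.X - Polynomial.C μ) ^ p.natDegree * (r μ * ∏ j ∈ t \ {μ}, s j) := by
      obtain ⟨d, hd⟩ := Nat.exists_eq_add_of_le hle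
      refine ⟨(Polynomial.X - Polynomial.C μ) ^ d * r μ, ?_⟩
      rw [hd]
      have h2 : p = s μ * ∏ j ∈ t \ {μ}, s j := by
        rw [hprod, ← Finset.mul_prod_erase t s hμ, Finset.sdiff_singleton_eq_erase]
      rw [show p * ((Polynomial.X - Polynomial.C μ) ^ d * r μ) =
        (s μ * ∏ j ∈ t \ {μ}, s j) * ((Polynomial.X - Polynomial.C μ) ^ d * r μ) by rw [← h2],
        pow_add]
      simp only [hs]
      ring
    obtain ⟨q, hq⟩ := hdvd
    rw [h1, ← map_pow, ← map_mul, hq, map_mul, hCH, zero_mul]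
  · intro μ
    have := Commute.map (Commute.all (Polynomial.X : Polynomial ℂ) (r μ * ∏ j ∈ t \ {μ}, s j))
      (Polynomial.aeval T)
    rwa [Polynomial.aeval_X] at this
  · rw [← map_sum, hr, map_one]

/-- A real inner product on a complex vector space that is the real part of a Hermitian one. -/
theorem exists_real_inner_product (V : Type*) [AddCommGroup V] [Module ℂ V]
    [FiniteDimensional ℂ V] :
    ∃ g : V →ₗ[ℝ] V →ₗ[ℝ] ℝ, (∀ x y, g x y = g y x) ∧ (∀ x, 0 ≤ g x x) ∧
      (∀ x, g x x = 0 → x = 0) ∧ ∀ (μ : ℂ) x, g (μ • x) x = μ.re * g x x := by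
  let φ : V →ₗ[ℂ] EuclideanSpace ℂ (Fin (Module.finrank ℂ V)) :=
    ((Module.finBasis ℂ V).equivFun.trans (WithLp.linearEquiv 2 ℂ _).symm).toLinearMap
  have hφ : Function.Injective φ := LinearEquiv.injective _
  let _ : InnerProductSpace ℝ (EuclideanSpace ℂ (Fin (Module.finrank ℂ V))) :=
    InnerProductSpace.complexToReal
  refine ⟨(innerₗ (EuclideanSpace ℂ (Fin (Module.finrank ℂ V)))).compl₁₂
    (φ.restrictScalars ℝ) (φ.restrictScalars ℝ), ?_, ?_, ?_, ?_⟩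
  · intro x y
    exact real_inner_comm (φ y) (φ x)
  · intro x
    exact real_inner_self_nonneg (x := φ x)
  · intro x hx
    have : φ x = 0 := (inner_self_eq_zero (𝕜 := ℝ) (x := φ x)).1 hx
    exact hφ (by simpa using this)
  · intro μ x
    change inner ℝ (φ (μ • x)) (φ x) = μ.re * inner ℝ (φ x) (φ x)
    rw [map_smul, real_inner_eq_re_inner ℂ, real_inner_eq_re_inner ℂ, inner_smul_left]
    rw [inner_self_eq_norm_sq_to_K]
    simp [← Complex.ofReal_pow]

end SpectralResolution

section LyapunovForm

variable {V : Type*} [AddCommGroup V] [Module ℂ V]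

/-- The adapted quadratic form of a nilpotent perturbation of a scalar operator. -/
theorem abs_sum_sub_le (g : V →ₗ[ℝ] V →ₗ[ℝ] ℝ) (hsymm : ∀ x y, g x y = g y x)
    (hpos : ∀ x, 0 ≤ g x x) (hμ : ∀ (μ : ℂ) x, g (μ • x) x = μ.re * g x x)
    {T : Module.End ℂ V} {μ : ℂ} {n : ℕ} {y : V} (hn : ((T - μ • 1) ^ n) y = 0)
    {δ : ℝ} (hδ : 0 < δ) :
    |∑ j ∈ Finset.range n, (δ⁻¹ ^ 2) ^ j *
        g (((T - μ • 1) ^ j) (T y)) (((T - μ • 1) ^ j) y)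
      - μ.re * ∑ j ∈ Finset.range n, (δ⁻¹ ^ 2) ^ j *
        g (((T - μ • 1) ^ j) y) (((T - μ • 1) ^ j) y)| ≤
    δ * ∑ j ∈ Finset.range n, (δ⁻¹ ^ 2) ^ j *
        g (((T - μ • 1) ^ j) y) (((T - μ • 1) ^ j) y) := by
  set N := T - μ • (1 : Module.End ℂ V) with hN
  set G : ℕ → ℝ := fun j => g ((N ^ j) y) ((N ^ j) y) with hG
  have hT : ∀ j, (N ^ j) (T y) = μ • (N ^ j) y + (N ^ (j + 1)) y := by
    intro j
    have h1 : T y = μ • y + N y := by simp [hN]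
    rw [h1, map_add, map_smul, pow_succ, Module.End.mul_apply]
  -- Young's inequality with parameter `δ`. The weights `δ^{-2j}` are matched to it: multiplied by
  -- `δ^{-2j}`, the bound becomes `δ/2` times the sum of the weighted terms of index `j + 1` and
  -- `j`.
  have hcs : ∀ x z : V, |g x z| ≤ (δ⁻¹ * g x x + δ * g z z) / 2 := by
    intro x z
    have h1 := hpos (x + δ • z)
    have h2 := hpos (x - δ • z)
    simp only [map_add, map_sub, map_smul, LinearMap.add_apply, LinearMap.sub_apply,
      LinearMap.smul_apply, smul_eq_mul, hsymm z x] at h1 h2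
    have h3 : δ⁻¹ * g x x + δ * g z z = δ⁻¹ * (g x x + δ * δ * g z z) := by
      field_simp
    rw [abs_le, h3]
    have h4 : δ⁻¹ * δ = 1 := inv_mul_cancel₀ hδ.ne'
    have h5 := mul_nonneg (inv_nonneg.2 hδ.le) h1
    have h6 := mul_nonneg (inv_nonneg.2 hδ.le) h2
    have h7 : δ⁻¹ * (g x x + δ * g x z + δ * (g x z + δ * g z z)) =
      δ⁻¹ * (g x x + δ * δ * g z z) + 2 * (δ⁻¹ * δ) * g x z := by ring
    have h8 : δ⁻¹ * (g x x - δ * g x z - δ * (g x z - δ * g z z)) =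
      δ⁻¹ * (g x x + δ * δ * g z z) - 2 * (δ⁻¹ * δ) * g x z := by ring
    rw [h4] at h7 h8
    constructor <;> linarith
  have hdiff : ∑ j ∈ Finset.range n, (δ⁻¹ ^ 2) ^ j * g ((N ^ j) (T y)) ((N ^ j) y)
      - μ.re * ∑ j ∈ Finset.range n, (δ⁻¹ ^ 2) ^ j * G j =
      ∑ j ∈ Finset.range n, (δ⁻¹ ^ 2) ^ j * g ((N ^ (j + 1)) y) ((N ^ j) y) := by
    rw [Finset.mul_sum, ← Finset.sum_sub_distrib]
    refine Finset.sum_congr rfl fun j _ => ?_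
    rw [hT, map_add, LinearMap.add_apply, hμ]
    simp only [hG]
    ring
  -- Shifting the index drops `G 0 ≥ 0` and adds `G n`, which vanishes because `N^n y = 0`.
  have hsum : ∑ j ∈ Finset.range n, (δ⁻¹ ^ 2) ^ (j + 1) * G (j + 1) ≤
      ∑ j ∈ Finset.range n, (δ⁻¹ ^ 2) ^ j * G j := by
    have h1 := Finset.sum_range_succ' (fun j => (δ⁻¹ ^ 2) ^ j * G j) n
    have h2 := Finset.sum_range_succ (fun j => (δ⁻¹ ^ 2) ^ j * G j) n
    have h3 : G n = 0 := by simp [hG, hn]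
    have h4 : 0 ≤ G 0 := hpos _
    rw [h3] at h2
    simp only [pow_zero, one_mul, mul_zero, add_zero] at h1 h2
    linarith
  change |∑ j ∈ Finset.range n, (δ⁻¹ ^ 2) ^ j * g ((N ^ j) (T y)) ((N ^ j) y)
      - μ.re * ∑ j ∈ Finset.range n, (δ⁻¹ ^ 2) ^ j * G j| ≤
    δ * ∑ j ∈ Finset.range n, (δ⁻¹ ^ 2) ^ j * G j
  rw [hdiff]
  calc _ ≤ ∑ j ∈ Finset.range n, |(δ⁻¹ ^ 2) ^ j * g ((N ^ (j + 1)) y) ((N ^ j) y)| :=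
        Finset.abs_sum_le_sum_abs _ _
    _ ≤ ∑ j ∈ Finset.range n, δ / 2 * ((δ⁻¹ ^ 2) ^ (j + 1) * G (j + 1) + (δ⁻¹ ^ 2) ^ j * G j) := by
        refine Finset.sum_le_sum fun j _ => ?_
        rw [abs_mul, abs_of_nonneg (by positivity)]
        have h1 := mul_le_mul_of_nonneg_left (hcs ((N ^ (j + 1)) y) ((N ^ j) y))
          (show (0 : ℝ) ≤ (δ⁻¹ ^ 2) ^ j by positivity)
        refine h1.trans (le_of_eq ?_)
        simp only [hG]
        rw [pow_succ (δ⁻¹ ^ 2) j]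
        field_simp
    _ ≤ _ := by
        rw [← Finset.mul_sum, Finset.sum_add_distrib]
        have := mul_le_mul_of_nonneg_left hsum (show (0 : ℝ) ≤ δ / 2 by positivity)
        linarith

end LyapunovForm

section RealLyapunov

variable {E : Type*} [AddCommGroup E] [Module ℝ E]

/-- The vector `1 ⊗ x` is the sum of its components `P μ (1 ⊗ x)`, each in the generalized
eigenspace of `μ`; only those with `μ ∈ s` survive. -/
theorem mem_spectralSubspace_of_sum {T : E →ₗ[ℝ] E} {t : Finset ℂ} {n : ℕ}
    {P : ℂ → Module.End ℂ (TensorProduct ℝ ℂ E)}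
    (hP : ∀ μ ∈ t, (T.baseChange ℂ - μ • 1) ^ n * P μ = 0) (hsum : ∑ μ ∈ t, P μ = 1)
    {s : Set ℂ} {x : E}
    (hx : ∀ μ ∈ t, μ ∉ s → P μ (TensorProduct.mk ℝ ℂ E 1 x) = 0) :
    x ∈ spectralSubspace T s := by
  change TensorProduct.mk ℝ ℂ E 1 x ∈ ⨆ μ ∈ s, Module.End.maxGenEigenspace (T.baseChange ℂ) μ
  have h1 : TensorProduct.mk ℝ ℂ E 1 x = ∑ μ ∈ t, P μ (TensorProduct.mk ℝ ℂ E 1 x) := by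
    rw [← LinearMap.sum_apply, hsum, Module.End.one_apply]
  rw [h1]
  refine Submodule.sum_mem _ fun μ hμ => ?_
  by_cases hs : μ ∈ s
  · refine Submodule.mem_iSup_of_mem μ (Submodule.mem_iSup_of_mem hs ?_)
    rw [Module.End.mem_maxGenEigenspace]
    exact ⟨n, by rw [← Module.End.mul_apply, hP μ hμ, LinearMap.zero_apply]⟩
  · rw [hx μ hμ hs]
    exact Submodule.zero_mem _

/-- Quadratic forms that grow, respectively decay, along the flow of a hyperbolic operator and
whose null spaces are the negative and the positive spectral subspaces. -/
theorem exists_lyapunov_forms [FiniteDimensional ℝ E] (T : E →ₗ[ℝ] E) (hT : IsHyperbolic T) :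
    ∃ (a b : LinearMap.BilinForm ℝ E) (c : ℝ), 0 < c ∧
      (∀ x y, a x y = a y x) ∧ (∀ x y, b x y = b y x) ∧
      (∀ x, 0 ≤ a x x) ∧ (∀ x, 0 ≤ b x x) ∧
      (∀ x, c * a x x ≤ a (T x) x) ∧ (∀ x, b (T x) x ≤ -(c * b x x)) ∧
      (∀ x, a x x = 0 → x ∈ negSpectralSubspace T) ∧
      (∀ x, b x x = 0 → x ∈ posSpectralSubspace T) ∧
      (∀ x, a x x = 0 → b x x = 0 → x = 0) := by
  classical
  obtain ⟨t, n, P, heig, hP, hcomm, hsum⟩ := exists_spectral_resolution (T.baseChange ℂ)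
  obtain ⟨g, hsymm, hpos, hdef, hμg⟩ := exists_real_inner_product (TensorProduct ℝ ℂ E)
  have hre : ∀ μ ∈ t, μ.re ≠ 0 := fun μ hμ => hT μ (heig μ hμ)
  -- `δ` is at most half the distance from the spectrum to the imaginary axis, so the error `δ`
  -- caused by the nilpotent part still leaves a rate of at least `δ`.
  obtain ⟨δ, hδ, hδt⟩ : ∃ δ : ℝ, 0 < δ ∧ ∀ μ ∈ t, 2 * δ ≤ |μ.re| := by
    rcases t.eq_empty_or_nonempty with h0 | hne
    · exact ⟨1, one_pos, by simp [h0]⟩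
    · obtain ⟨μ₀, hμ₀, hmin⟩ := t.exists_min_image (fun μ => |μ.re|) hne
      refine ⟨|μ₀.re| / 2, half_pos (abs_pos.2 (hre μ₀ hμ₀)), fun μ hμ => ?_⟩
      linarith [hmin μ hμ]
  let ι : E →ₗ[ℝ] TensorProduct ℝ ℂ E := TensorProduct.mk ℝ ℂ E 1
  have hιT : ∀ x, ι (T x) = T.baseChange ℂ (ι x) := fun x => rfl
  let L : ℂ → ℕ → E →ₗ[ℝ] TensorProduct ℝ ℂ E := fun μ j =>
    (((T.baseChange ℂ - μ • 1) ^ j * P μ).restrictScalars ℝ) ∘ₗ ι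
  have hL : ∀ μ j x, L μ j x = ((T.baseChange ℂ - μ • 1) ^ j) (P μ (ι x)) := fun μ j x => rfl
  -- The range is `n + 1` rather than `n` so that the term `j = 0` is present even for `n = 0`; it
  -- makes the null vectors of `f μ` have zero `μ`-component.
  let f : ℂ → LinearMap.BilinForm ℝ E := fun μ =>
    ∑ j ∈ Finset.range (n + 1), (δ⁻¹ ^ 2) ^ j • g.compl₁₂ (L μ j) (L μ j)
  have hf : ∀ μ x y, f μ x y = ∑ j ∈ Finset.range (n + 1), (δ⁻¹ ^ 2) ^ j *
      g (((T.baseChange ℂ - μ • 1) ^ j) (P μ (ι x)))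
        (((T.baseChange ℂ - μ • 1) ^ j) (P μ (ι y))) := by
    intro μ x y
    simp only [f, LinearMap.sum_apply, LinearMap.smul_apply, smul_eq_mul]
    rfl
  have hfsymm : ∀ μ x y, f μ x y = f μ y x := fun μ x y => by
    rw [hf, hf]
    exact Finset.sum_congr rfl fun j _ => by rw [hsymm]
  have hfterm : ∀ (μ : ℂ) (x : E), ∀ j ∈ Finset.range (n + 1), 0 ≤ (δ⁻¹ ^ 2) ^ j *
      g (((T.baseChange ℂ - μ • 1) ^ j) (P μ (ι x)))
        (((T.baseChange ℂ - μ • 1) ^ j) (P μ (ι x))) := fun μ x j _ =>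
    mul_nonneg (by positivity) (hpos _)
  have hfpos : ∀ μ x, 0 ≤ f μ x x := fun μ x => by
    rw [hf]
    exact Finset.sum_nonneg (hfterm μ x)
  have hfzero : ∀ μ x, f μ x x = 0 → P μ (ι x) = 0 := by
    intro μ x h
    rw [hf, Finset.sum_eq_zero_iff_of_nonneg (hfterm μ x)] at h
    have h0 := h 0 (by simp)
    simp only [pow_zero, one_mul, Module.End.one_apply] at h0
    exact hdef _ h0
  have hfT : ∀ μ ∈ t, ∀ x, |f μ (T x) x - μ.re * f μ x x| ≤ δ * f μ x x := by
    intro μ hμ x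
    have h0 : ((T.baseChange ℂ - μ • 1) ^ (n + 1)) (P μ (ι x)) = 0 := by
      rw [pow_succ', Module.End.mul_apply, ← Module.End.mul_apply _ (P μ), hP μ hμ]
      simp
    have h1 : P μ (ι (T x)) = T.baseChange ℂ (P μ (ι x)) := by
      rw [hιT, ← Module.End.mul_apply, ← Module.End.mul_apply, (hcomm μ).eq]
    have := abs_sum_sub_le g hsymm hpos hμg h0 hδ
    rw [hf, hf, h1]
    exact this
  let F : (ℂ → Prop) → LinearMap.BilinForm ℝ E := fun q => ∑ μ ∈ t with q μ, f μ
  have hF : ∀ q x y, F q x y = ∑ μ ∈ t with q μ, f μ x y := fun q x y => by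
    simp only [F, LinearMap.sum_apply]
  have hFzero : ∀ q x, F q x x = 0 → ∀ μ ∈ t, q μ → P μ (ι x) = 0 := by
    intro q x h μ hμ hq
    rw [hF, Finset.sum_eq_zero_iff_of_nonneg (fun μ _ => hfpos μ x)] at h
    exact hfzero μ x (h μ (Finset.mem_filter.2 ⟨hμ, hq⟩))
  refine ⟨F fun μ => 0 < μ.re, F fun μ => μ.re < 0, δ, hδ, ?_, ?_, ?_, ?_, ?_, ?_, ?_, ?_, ?_⟩
  · intro x y
    rw [hF, hF]
    exact Finset.sum_congr rfl fun μ _ => hfsymm μ x y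
  · intro x y
    rw [hF, hF]
    exact Finset.sum_congr rfl fun μ _ => hfsymm μ x y
  · intro x
    rw [hF]
    exact Finset.sum_nonneg fun μ _ => hfpos μ x
  · intro x
    rw [hF]
    exact Finset.sum_nonneg fun μ _ => hfpos μ x
  · intro x
    rw [hF, hF, Finset.mul_sum]
    refine Finset.sum_le_sum fun μ hμ => ?_
    obtain ⟨hμt, hμ0⟩ := Finset.mem_filter.1 hμ
    have h1 := (abs_le.1 (hfT μ hμt x)).1
    have h2 := hδt μ hμt
    rw [abs_of_pos hμ0] at h2
    nlinarith [hfpos μ x]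
  · intro x
    rw [hF, hF, Finset.mul_sum, ← Finset.sum_neg_distrib]
    refine Finset.sum_le_sum fun μ hμ => ?_
    obtain ⟨hμt, hμ0⟩ := Finset.mem_filter.1 hμ
    have h1 := (abs_le.1 (hfT μ hμt x)).2
    have h2 := hδt μ hμt
    rw [abs_of_neg hμ0] at h2
    nlinarith [hfpos μ x]
  · intro x hx
    refine mem_spectralSubspace_of_sum hP hsum fun μ hμ hs => hFzero _ x hx μ hμ ?_
    exact lt_of_le_of_ne (not_lt.1 hs) (hre μ hμ).symm
  · intro x hx
    refine mem_spectralSubspace_of_sum hP hsum fun μ hμ hs => hFzero _ x hx μ hμ ?_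
    exact lt_of_le_of_ne (not_lt.1 hs) (hre μ hμ)
  · intro x ha hb
    -- No eigenvalue is on the imaginary axis, so the two forms together control all components, and
    -- `x` lies in the spectral subspace of the empty set. Injectivity of `x ↦ 1 ⊗ x` then gives `x
    -- = 0`.
    have h1 : x ∈ spectralSubspace T ∅ := by
      refine mem_spectralSubspace_of_sum hP hsum fun μ hμ _ => ?_
      rcases lt_or_gt_of_ne (hre μ hμ) with h | h
      · exact hFzero _ x hb μ hμ h
      · exact hFzero _ x ha μ hμ h
    have h2 : ι x ∈ ⨆ μ ∈ (∅ : Set ℂ), Module.End.maxGenEigenspace (T.baseChange ℂ) μ := h1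
    simp only [Set.mem_empty_iff_false, iSup_false, iSup_bot, Submodule.mem_bot] at h2
    have hflat : Function.Injective ι := by
      intro x y hxy
      exact Module.FaithfullyFlat.tensorProduct_mk_injective (A := ℝ) (B := ℂ) E hxy
    exact hflat (by simpa using h2)

end RealLyapunov

/-! ### Behaviour of the stable subspaces at infinity -/

section Asymptotics

variable {E : Type*} [NormedAddCommGroup E] [NormedSpace ℝ E] [FiniteDimensional ℝ E]

theorem exists_pos_mul_sq_norm_le (q : LinearMap.BilinForm ℝ E) (hq : ∀ x, x ≠ 0 → 0 < q x x) :
    ∃ c > 0, ∀ x, c * ‖x‖ ^ 2 ≤ q x x := by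
  have hcont : Continuous fun x => q x x := by
    have := (LinearMap.toContinuousBilinearMap q).continuous₂
    exact this.comp (continuous_id.prodMk continuous_id)
  -- The sphere is empty when `E` is trivial, which happens for `k = 0`.
  rcases (Metric.sphere (0 : E) 1).eq_empty_or_nonempty with h0 | hne
  · refine ⟨1, one_pos, fun x => ?_⟩
    have hx : x = 0 := by
      by_contra hx
      have : ‖x‖⁻¹ • x ∈ Metric.sphere (0 : E) 1 := by
        simp [norm_smul, hx]
      rw [h0] at this
      exact this
    simp [hx]
  · obtain ⟨x₀, hx₀, hmin⟩ := (isCompact_sphere (0 : E) 1).exists_isMinOn hne hcont.continuousOn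
    refine ⟨q x₀ x₀, hq x₀ (by rintro rfl; simp at hx₀), fun x => ?_⟩
    by_cases hx : x = 0
    · simp [hx]
    have hn : 0 < ‖x‖ := norm_pos_iff.2 hx
    have h1 : q x₀ x₀ ≤ q (‖x‖⁻¹ • x) (‖x‖⁻¹ • x) :=
      hmin (show ‖x‖⁻¹ • x ∈ Metric.sphere (0 : E) 1 by simp [norm_smul, hx])
    simp only [map_smul, LinearMap.smul_apply, smul_eq_mul] at h1
    calc q x₀ x₀ * ‖x‖ ^ 2 ≤ (‖x‖⁻¹ * (‖x‖⁻¹ * q x x)) * ‖x‖ ^ 2 := by gcongr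
      _ = q x x := by field_simp

/-- Decaying solutions eventually lie in the nonpositive cone of every strict Lyapunov form of
the limit system. -/
theorem eventually_nonpos_of_mem_stableSubspace {S : ℝ → E →L[ℝ] E} {T : E →L[ℝ] E}
    (hS : Tendsto S atTop (𝓝 T)) (q : LinearMap.BilinForm ℝ E) (hsymm : ∀ x y, q x y = q y x)
    (hq : ∀ x, x ≠ 0 → 0 < q (T x) x) :
    ∀ᶠ t in atTop, ∀ v ∈ stableSubspace S t, q v v ≤ 0 := by
  obtain ⟨c, hc, hcq⟩ := exists_pos_mul_sq_norm_le (q ∘ₗ (T : E →ₗ[ℝ] E)) hq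
  set Q := LinearMap.toContinuousBilinearMap q with hQ
  have hQq : ∀ x y, Q x y = q x y := fun x y => rfl
  -- The quadratic lower bound `c` for `q (T x) x` absorbs the perturbation `S t - T` as soon as
  -- `‖Q‖ ‖S t - T‖ < c`.
  have hlim : Tendsto (fun t => ‖Q‖ * ‖S t - T‖) atTop (𝓝 0) := by
    have := (tendsto_iff_norm_sub_tendsto_zero.1 hS).const_mul ‖Q‖
    simpa using this
  have hev : ∀ᶠ t in atTop, ∀ x, 0 ≤ q (S t x) x := by
    filter_upwards [hlim.eventually_lt_const hc] with t ht x
    have h1 : q (S t x) x = q (T x) x + Q ((S t - T) x) x := by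
      rw [hQq, sub_apply, map_sub, LinearMap.sub_apply]
      ring
    have h2 : ‖Q ((S t - T) x) x‖ ≤ ‖Q‖ * (‖S t - T‖ * ‖x‖) * ‖x‖ :=
      (Q.le_opNorm₂ _ _).trans (by gcongr; exact (S t - T).le_opNorm x)
    have h3 := (abs_le.1 (Real.norm_eq_abs _ ▸ h2)).1
    have h4 : c * ‖x‖ ^ 2 ≤ q (T x) x := hcq x
    have h5 : ‖Q‖ * (‖S t - T‖ * ‖x‖) * ‖x‖ ≤ c * ‖x‖ ^ 2 := by
      calc ‖Q‖ * (‖S t - T‖ * ‖x‖) * ‖x‖ = (‖Q‖ * ‖S t - T‖) * ‖x‖ ^ 2 := by ring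
        _ ≤ c * ‖x‖ ^ 2 := by gcongr
    rw [h1]
    linarith
  obtain ⟨T₀, hT₀⟩ := eventually_atTop.1 hev
  filter_upwards [eventually_ge_atTop T₀] with t ht
  rintro _ ⟨u, hu, rfl, hul⟩
  have hd : ∀ s, HasDerivAt (fun s => q (u s) (u s)) (2 * q (S s (u s)) (u s)) s := fun s => by
    have := HasDerivAt.bilin q (hu s) (hu s)
    rwa [hsymm (u s), ← two_mul] at this
  -- Along a decaying solution `q` is nondecreasing from `T₀` on and tends to `0`, hence it is
  -- nonpositive there.
  have hmono : MonotoneOn (fun s => q (u s) (u s)) (Set.Ici T₀) := by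
    refine monotoneOn_of_deriv_nonneg (convex_Ici T₀)
      (fun s _ => (hd s).continuousAt.continuousWithinAt)
      (fun s _ => (hd s).differentiableAt.differentiableWithinAt) fun s hs => ?_
    rw [(hd s).deriv]
    rw [interior_Ici] at hs
    have := hT₀ s (le_of_lt hs) (u s)
    linarith
  have hl : Tendsto (fun s => q (u s) (u s)) atTop (𝓝 0) := by
    have h1 : Tendsto (fun s => q (u s) (u s)) atTop (𝓝 (q 0 0)) :=
      (Q.continuous₂.tendsto (0, 0)).comp (hul.prodMk_nhds hul)
    simpa using h1
  refine ge_of_tendsto hl ?_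
  filter_upwards [eventually_ge_atTop t] with s hs
  exact hmono ht (ht.trans hs) hs

/-- Limits of vectors in the stable subspaces are null vectors of the growing Lyapunov form. -/
theorem eq_zero_of_tendsto_stableSubspace {S : ℝ → E →L[ℝ] E} {T : E →L[ℝ] E}
    (hS : Tendsto S atTop (𝓝 T)) {a b : LinearMap.BilinForm ℝ E} {c : ℝ} (hc : 0 < c)
    (hasymm : ∀ x y, a x y = a y x) (hbsymm : ∀ x y, b x y = b y x)
    (ha : ∀ x, 0 ≤ a x x) (hb : ∀ x, 0 ≤ b x x)
    (haT : ∀ x, c * a x x ≤ a (T x) x) (hbT : ∀ x, b (T x) x ≤ -(c * b x x))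
    (hdef : ∀ x, a x x = 0 → b x x = 0 → x = 0)
    {t : ℕ → ℝ} (ht : Tendsto t atTop atTop) {v : ℕ → E} {w : E} (hv : Tendsto v atTop (𝓝 w))
    (hmem : ∀ n, v n ∈ stableSubspace S (t n)) : a w w = 0 := by
  by_contra hne
  have hpos : 0 < a w w := lt_of_le_of_ne (ha w) (Ne.symm hne)
  -- `M • a - b` is a strict Lyapunov form for every `M > 0`. This `M` gives it the value `1` at
  -- `w`, whereas the limit of vectors in the stable subspaces must have a nonpositive value.
  set M : ℝ := (b w w + 1) / a w w with hM
  have hMpos : 0 < M := div_pos (by linarith [hb w]) hpos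
  have hev := eventually_nonpos_of_mem_stableSubspace hS (M • a - b)
    (fun x y => by
      simp only [LinearMap.sub_apply, LinearMap.smul_apply, hasymm x y, hbsymm x y])
    (fun x hx => by
      simp only [LinearMap.sub_apply, LinearMap.smul_apply, smul_eq_mul]
      have h1 := haT x
      have h2 := hbT x
      rcases (ha x).eq_or_lt with h0 | h0
      · have h3 : 0 < b x x := lt_of_le_of_ne (hb x) fun h => hx (hdef x h0.symm h.symm)
        have h4 := mul_pos hc h3
        have h5 : 0 ≤ M * a (T x) x := mul_nonneg hMpos.le (by rw [← h0] at h1; linarith)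
        linarith
      · have h3 : 0 < a (T x) x := (mul_pos hc h0).trans_le h1
        have h4 := mul_nonneg hc.le (hb x)
        have h5 := mul_pos hMpos h3
        linarith)
  have hq : Continuous fun x => (M • a - b) x x := by
    have := (LinearMap.toContinuousBilinearMap (M • a - b)).continuous₂
    exact this.comp (continuous_id.prodMk continuous_id)
  have hle : (M • a - b) w w ≤ 0 := by
    refine le_of_tendsto ((hq.tendsto w).comp hv) ?_
    filter_upwards [ht.eventually hev] with n hn
    exact hn _ (hmem n)
  simp only [LinearMap.sub_apply, LinearMap.smul_apply, smul_eq_mul, hM] at hle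
  rw [div_mul_cancel₀ _ hpos.ne'] at hle
  linarith

end Asymptotics

/-! ## Spectral subspaces of infinitesimally symplectic operators -/

section Isotropy

variable {k : ℕ}

/-- Skewness gives `(μ + ν) B(x, y) = -B((T - μ)x, y) - B(x, (T - ν)y)`. Both terms on the right
have a smaller total exponent, so induction on `m + n` applies. -/
theorem eq_zero_of_genEigenvectors {V : Type*} [AddCommGroup V] [Module ℂ V]
    (B : LinearMap.BilinForm ℂ V) {T : Module.End ℂ V}
    (hT : ∀ x y, B (T x) y + B x (T y) = 0) {μ ν : ℂ} (h : μ + ν ≠ 0) (N : ℕ) :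
    ∀ m n : ℕ, m + n = N → ∀ x y, ((T - μ • 1) ^ m) x = 0 → ((T - ν • 1) ^ n) y = 0 →
      B x y = 0 := by
  induction N with
  | zero =>
    intro m n hmn x y hx hy
    obtain rfl : m = 0 := by omega
    simp only [pow_zero, Module.End.one_apply] at hx
    simp [hx]
  | succ N ih =>
    intro m n hmn x y hx hy
    rcases m with _ | m
    · simp only [pow_zero, Module.End.one_apply] at hx
      simp [hx]
    rcases n with _ | n
    · simp only [pow_zero, Module.End.one_apply] at hy
      simp [hy]
    have h1 := ih m (n + 1) (by omega) ((T - μ • 1) x) y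
      (by rw [pow_succ, Module.End.mul_apply] at hx; exact hx) hy
    have h2 := ih (m + 1) n (by omega) x ((T - ν • 1) y) hx
      (by rw [pow_succ, Module.End.mul_apply] at hy; exact hy)
    have h3 := hT x y
    simp only [LinearMap.sub_apply, LinearMap.smul_apply, Module.End.one_apply, map_sub, map_smul,
      smul_eq_mul] at h1 h2
    have h4 : (μ + ν) * B x y = 0 := by linear_combination h3 - h1 - h2
    exact (mul_eq_zero.1 h4).resolve_left h

theorem baseChange_skew {E : Type*} [AddCommGroup E] [Module ℝ E] (B : LinearMap.BilinForm ℝ E)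
    {T : E →ₗ[ℝ] E} (hT : ∀ x y, B (T x) y + B x (T y) = 0) (x y : TensorProduct ℝ ℂ E) :
    B.baseChange ℂ (T.baseChange ℂ x) y + B.baseChange ℂ x (T.baseChange ℂ y) = 0 := by
  induction x using TensorProduct.induction_on with
  | zero => simp
  | add x₁ x₂ h₁ h₂ =>
    simp only [map_add, LinearMap.add_apply]
    linear_combination h₁ + h₂
  | tmul z x =>
    induction y using TensorProduct.induction_on with
    | zero => simp
    | add y₁ y₂ h₁ h₂ =>
      simp only [map_add]
      linear_combination h₁ + h₂
    | tmul w y =>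
      simp only [LinearMap.baseChange_tmul, LinearMap.BilinForm.baseChange_tmul]
      rw [← add_smul, hT, zero_smul]

/-- Over `ℂ`, generalized eigenspaces for `μ` and `ν` with `μ + ν ≠ 0` are orthogonal for the
extended form; this passes to sums of such spaces and restricts to real vectors. -/
theorem isIsotropic_spectralSubspace {T : PhaseSpace k →ₗ[ℝ] PhaseSpace k}
    (hT : IsInfinitesimallySymplectic T) {s : Set ℂ} (hs : ∀ μ ∈ s, ∀ ν ∈ s, μ + ν ≠ 0) :
    IsIsotropic (spectralSubspace T s) := by
  intro x hx y hy
  set B := (symplecticForm k).baseChange ℂ with hB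
  set W := ⨆ μ ∈ s, Module.End.maxGenEigenspace (T.baseChange ℂ) μ with hW
  have hskew := baseChange_skew (symplecticForm k) hT
  have key : ∀ z ∈ W, ∀ w ∈ W, B z w = 0 := by
    intro z hz w hw
    have h1 : W ≤ LinearMap.ker (B.flip w) := by
      refine iSup₂_le fun μ hμ z hz => ?_
      change B z w = 0
      have h2 : W ≤ LinearMap.ker (B z) := by
        refine iSup₂_le fun ν hν w hw => ?_
        rw [LinearMap.mem_ker]
        obtain ⟨m, hm⟩ := (Module.End.mem_maxGenEigenspace _ _ _).1 hz
        obtain ⟨n, hn⟩ := (Module.End.mem_maxGenEigenspace _ _ _).1 hw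
        exact eq_zero_of_genEigenvectors B hskew (hs μ hμ ν hν) (m + n) m n rfl z w hm hn
      exact h2 hw
    exact h1 hz
  have h := key (TensorProduct.mk ℝ ℂ _ 1 x) hx (TensorProduct.mk ℝ ℂ _ 1 y) hy
  simp only [TensorProduct.mk_apply, hB, LinearMap.BilinForm.baseChange_tmul] at h
  simpa using h

theorem isIsotropic_negSpectralSubspace {T : PhaseSpace k →ₗ[ℝ] PhaseSpace k}
    (hT : IsInfinitesimallySymplectic T) : IsIsotropic (negSpectralSubspace T) :=
  isIsotropic_spectralSubspace hT fun μ hμ ν hν h => by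
    have h1 : μ.re < 0 := hμ
    have h2 : ν.re < 0 := hν
    have := congrArg Complex.re h
    simp at this
    linarith

theorem isIsotropic_posSpectralSubspace {T : PhaseSpace k →ₗ[ℝ] PhaseSpace k}
    (hT : IsInfinitesimallySymplectic T) : IsIsotropic (posSpectralSubspace T) :=
  isIsotropic_spectralSubspace hT fun μ hμ ν hν h => by
    have h1 : 0 < μ.re := hμ
    have h2 : 0 < ν.re := hν
    have := congrArg Complex.re h
    simp at this
    linarith

/-- Transversal isotropic subspaces are complementary subspaces of dimension `k`. -/
theorem Transversal.of_isIsotropic {V W : Submodule ℝ (PhaseSpace k)} (h : Transversal V W)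
    (hV : IsIsotropic V) (hW : IsIsotropic W) :
    Module.finrank ℝ V = k ∧ Module.finrank ℝ W = k ∧ V ⊓ W = ⊥ := by
  have h1 := Submodule.finrank_sup_add_finrank_inf_eq V W
  have h2 : Module.finrank ℝ (PhaseSpace k) = k + k := by simp [finrank_euclideanSpace]
  rw [show V ⊔ W = ⊤ from h, finrank_top, h2] at h1
  have h3 := hV.finrank_le
  have h4 := hW.finrank_le
  refine ⟨by omega, by omega, Submodule.finrank_eq_zero.1 (by omega)⟩

theorem transversal_of_finrank {V W : Submodule ℝ (PhaseSpace k)}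
    (hV : Module.finrank ℝ V = k) (hW : Module.finrank ℝ W = k) (h : V ⊓ W = ⊥) :
    Transversal V W := by
  have h1 := Submodule.finrank_sup_add_finrank_inf_eq V W
  have h2 : Module.finrank ℝ (PhaseSpace k) = k + k := by simp [finrank_euclideanSpace]
  rw [h, finrank_bot, hV, hW, add_zero] at h1
  exact Submodule.eq_top_of_finrank_eq (h1.trans h2.symm)

end Isotropy

/-! ### Transversality of `E^s(t)` and `E^u(-t)` for large `t` -/

section EventualTransversality

variable {k : ℕ}

theorem tendsto_comp_neg {S : ℝ → PhaseSpace k →L[ℝ] PhaseSpace k}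
    {T : PhaseSpace k →L[ℝ] PhaseSpace k} (hS : Tendsto S atBot (𝓝 T)) :
    Tendsto (fun s => -S (-s)) atTop (𝓝 (-T)) :=
  (hS.comp tendsto_neg_atTop_atBot).neg

/-- The stable spaces at `t` and the unstable spaces at `-t` are eventually transversal. -/
theorem exists_forall_transversal {S : ℝ → PhaseSpace k →L[ℝ] PhaseSpace k}
    {Sm Sp : PhaseSpace k →L[ℝ] PhaseSpace k}
    (hSm : Tendsto S atBot (𝓝 Sm)) (hSp : Tendsto S atTop (𝓝 Sp))
    (hskm : IsInfinitesimallySymplectic (Sm : PhaseSpace k →ₗ[ℝ] PhaseSpace k))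
    (hskp : IsInfinitesimallySymplectic (Sp : PhaseSpace k →ₗ[ℝ] PhaseSpace k))
    (hypm : IsHyperbolic (Sm : PhaseSpace k →ₗ[ℝ] PhaseSpace k))
    (hypp : IsHyperbolic (Sp : PhaseSpace k →ₗ[ℝ] PhaseSpace k))
    (htrans : Transversal (posSpectralSubspace (Sm : PhaseSpace k →ₗ[ℝ] PhaseSpace k))
      (negSpectralSubspace (Sp : PhaseSpace k →ₗ[ℝ] PhaseSpace k)))
    (hs : ∀ t, Module.finrank ℝ (stableSubspace S t) = k)
    (hu : ∀ t, Module.finrank ℝ (unstableSubspace S t) = k) :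
    ∃ T > 0, ∀ t, T ≤ t → Transversal (stableSubspace S t) (unstableSubspace S (-t)) := by
  obtain ⟨ap, bp, cp, hcp, hasp, hbsp, hap, hbp, haTp, hbTp, hanp, -, hdefp⟩ :=
    exists_lyapunov_forms (Sp : PhaseSpace k →ₗ[ℝ] PhaseSpace k) hypp
  obtain ⟨am, bm, cm, hcm, hasm, hbsm, ham, hbm, haTm, hbTm, -, hbnm, hdefm⟩ :=
    exists_lyapunov_forms (Sm : PhaseSpace k →ₗ[ℝ] PhaseSpace k) hypm
  have hinf := (htrans.of_isIsotropic (isIsotropic_posSpectralSubspace hskm)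
    (isIsotropic_negSpectralSubspace hskp)).2.2
  suffices h : ∀ᶠ t in atTop, Transversal (stableSubspace S t) (unstableSubspace S (-t)) by
    obtain ⟨T, hT⟩ := eventually_atTop.1 h
    exact ⟨max T 1, by positivity, fun t ht => hT t ((le_max_left _ _).trans ht)⟩
  by_contra hcon
  -- If transversality fails at arbitrarily large times, there are common unit vectors at such
  -- times. Compactness of the sphere yields a unit limit `w` in `V^-(S^+) ∩ V^+(S^-)`, which is
  -- trivial.
  have hfreq : ∀ n : ℕ, ∃ t : ℝ, (n : ℝ) ≤ t ∧
      ∃ v : PhaseSpace k, ‖v‖ = 1 ∧ v ∈ stableSubspace S t ∧ v ∈ unstableSubspace S (-t) := by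
    intro n
    obtain ⟨t, ht, hnt⟩ := (frequently_atTop.1 (not_eventually.1 hcon)) n
    refine ⟨t, ht, ?_⟩
    have hne : stableSubspace S t ⊓ unstableSubspace S (-t) ≠ ⊥ := fun h =>
      hnt (transversal_of_finrank (hs t) (hu (-t)) h)
    obtain ⟨v, hv, hv0⟩ := Submodule.exists_mem_ne_zero_of_ne_bot hne
    refine ⟨‖v‖⁻¹ • v, by simp [norm_smul, hv0], Submodule.smul_mem _ _ hv.1,
      Submodule.smul_mem _ _ hv.2⟩
  choose t ht v hv1 hvs hvu using hfreq
  obtain ⟨w, hw, φ, hφ, hlim⟩ := (isCompact_sphere (0 : PhaseSpace k) 1).tendsto_subseq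
    (x := v) fun n => by simp [hv1]
  have htφ : Tendsto (t ∘ φ) atTop atTop :=
    (tendsto_atTop_mono ht tendsto_natCast_atTop_atTop).comp hφ.tendsto_atTop
  have h1 : ap w w = 0 := eq_zero_of_tendsto_stableSubspace hSp hcp hasp hbsp hap hbp haTp hbTp
    hdefp htφ hlim fun n => hvs (φ n)
  have h2 : bm w w = 0 := by
    -- After time reversal the limit operator is `-Sm`, for which `bm` grows and `am` decays: the
    -- two forms exchange roles.
    refine eq_zero_of_tendsto_stableSubspace (tendsto_comp_neg hSm) hcm hbsm hasm hbm ham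
      (fun x => ?_) (fun x => ?_) (fun x h h' => hdefm x h' h) htφ hlim fun n => ?_
    · have := hbTm x
      simp only [ContinuousLinearMap.coe_coe] at this
      simp only [neg_apply, map_neg, LinearMap.neg_apply]
      linarith
    · have := haTm x
      simp only [ContinuousLinearMap.coe_coe] at this
      simp only [neg_apply, map_neg, LinearMap.neg_apply]
      linarith
    · rw [← decayingSubspace_comp_neg]
      exact hvu (φ n)
  have h3 : w ∈ (⊥ : Submodule ℝ (PhaseSpace k)) := hinf ▸ ⟨hbnm w h2, hanp w h1⟩
  rw [Submodule.mem_bot] at h3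
  simp [h3] at hw

end EventualTransversality

/-! ## Orthonormal and unitary frames -/

section Frames

/-- Strong induction on the recursion formula: its denominators are norms of earlier Gram–Schmidt
vectors, which do not vanish for independent families. -/
theorem continuous_gramSchmidt {E X : Type*} [NormedAddCommGroup E] [InnerProductSpace ℝ E]
    [TopologicalSpace X] {m : ℕ} {v : X → Fin m → E} (hv : Continuous v)
    (hli : ∀ t, LinearIndependent ℝ (v t)) (n : Fin m) :
    Continuous fun t => InnerProductSpace.gramSchmidt ℝ (v t) n := by
  induction n using WellFoundedLT.induction with
  | ind n ih =>
    have hvn : Continuous fun t => v t n := (continuous_apply n).comp hv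
    have heq : (fun t => InnerProductSpace.gramSchmidt ℝ (v t) n) = fun t => v t n -
        ∑ i ∈ Finset.Iio n, (inner ℝ (InnerProductSpace.gramSchmidt ℝ (v t) i) (v t n) /
          (‖InnerProductSpace.gramSchmidt ℝ (v t) i‖) ^ 2) •
            InnerProductSpace.gramSchmidt ℝ (v t) i := by
      funext t
      exact eq_sub_of_add_eq (InnerProductSpace.gramSchmidt_def'' ℝ (v t) n).symm
    rw [heq]
    refine hvn.sub (continuous_finsetSum _ fun i hi => ?_)
    have hc := ih i (Finset.mem_Iio.1 hi)
    refine Continuous.smul ((hc.inner hvn).div (hc.norm.pow 2) fun t => ?_) hc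
    have := InnerProductSpace.gramSchmidt_ne_zero (𝕜 := ℝ) i (hli t)
    positivity

theorem exists_orthonormal_frame {E X : Type*} [NormedAddCommGroup E] [InnerProductSpace ℝ E]
    [TopologicalSpace X] {m : ℕ} {v : X → Fin m → E} (hv : Continuous v)
    (hli : ∀ t, LinearIndependent ℝ (v t)) :
    ∃ e : X → Fin m → E, Continuous e ∧ (∀ t, Orthonormal ℝ (e t)) ∧
      ∀ t, Submodule.span ℝ (Set.range (e t)) = Submodule.span ℝ (Set.range (v t)) := by
  refine ⟨fun t => InnerProductSpace.gramSchmidtNormed ℝ (v t), continuous_pi fun n => ?_,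
    fun t => InnerProductSpace.gramSchmidtNormed_orthonormal (hli t), fun t => ?_⟩
  · have hc := continuous_gramSchmidt hv hli n
    refine Continuous.smul (hc.norm.inv₀ fun t => ?_) hc
    exact norm_ne_zero_iff.2 (InnerProductSpace.gramSchmidt_ne_zero (𝕜 := ℝ) n (hli t))
  · rw [InnerProductSpace.span_gramSchmidtNormed_range, InnerProductSpace.span_gramSchmidt]

variable {k : ℕ}

/-- The real frame of `A ℝ^k` given by the columns of `A`. -/
def unitaryFrame (A : Matrix (Fin k) (Fin k) ℂ) (j : Fin k) : PhaseSpace k :=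
  WithLp.toLp 2 (Sum.elim (fun i => (A i j).re) (fun i => (A i j).im))

theorem span_unitaryFrame (A : Matrix (Fin k) (Fin k) ℂ) :
    Submodule.span ℝ (Set.range (unitaryFrame A)) = lagrangianOf A := rfl

theorem continuous_unitaryFrame : Continuous (unitaryFrame (k := k)) := by
  refine continuous_pi fun j => (PiLp.continuous_toLp 2 _).comp (continuous_pi fun i => ?_)
  rcases i with i | i
  · exact Complex.continuous_re.comp (continuous_id.matrix_elem i j)
  · exact Complex.continuous_im.comp (continuous_id.matrix_elem i j)

/-- The Hermitian product of `ℂ^k` has the scalar product as real part and `ω` as imaginary part.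
Hence unitary matrices correspond to orthonormal frames of isotropic subspaces. -/
theorem conjTranspose_mul_self_apply (A : Matrix (Fin k) (Fin k) ℂ) (j l : Fin k) :
    (A.conjTranspose * A) j l = (inner ℝ (unitaryFrame A j) (unitaryFrame A l) : ℝ) +
      (symplecticForm k (unitaryFrame A j) (unitaryFrame A l) : ℝ) * Complex.I := by
  rw [symplecticForm_eq_sum, PiLp.inner_apply, Matrix.mul_apply, Fintype.sum_sum_type,
    ← Finset.sum_add_distrib]
  push_cast
  rw [Finset.sum_mul, ← Finset.sum_add_distrib]
  refine Finset.sum_congr rfl fun i _ => ?_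
  apply Complex.ext <;> simp [unitaryFrame] <;> ring

theorem orthonormal_unitaryFrame {A : Matrix (Fin k) (Fin k) ℂ}
    (hA : A ∈ Matrix.unitaryGroup (Fin k) ℂ) : Orthonormal ℝ (unitaryFrame A) := by
  rw [orthonormal_iff_ite]
  intro j l
  have h1 := conjTranspose_mul_self_apply A j l
  rw [← Matrix.star_eq_conjTranspose, (Matrix.mem_unitaryGroup_iff').1 hA, Matrix.one_apply] at h1
  have h2 := congrArg Complex.re h1
  simp only [Complex.add_re, Complex.ofReal_re, Complex.mul_re, Complex.I_re, mul_zero,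
    Complex.ofReal_im, Complex.I_im, mul_one, sub_self, add_zero] at h2
  rw [← h2]
  split_ifs <;> simp

/-- The complex matrix whose columns are the given vectors of `ℝ^{2k} = ℂ^k`. -/
def complexMatrix (e : Fin k → PhaseSpace k) : Matrix (Fin k) (Fin k) ℂ :=
  Matrix.of fun i j => ⟨e j (Sum.inl i), e j (Sum.inr i)⟩

theorem unitaryFrame_complexMatrix (e : Fin k → PhaseSpace k) :
    unitaryFrame (complexMatrix e) = e := by
  funext j
  ext i
  rcases i with i | i <;> rfl

theorem continuous_complexMatrix : Continuous (complexMatrix (k := k)) := by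
  refine continuous_matrix fun i j => ?_
  have h : (fun e : Fin k → PhaseSpace k => complexMatrix e i j) = fun e =>
      ((e j (Sum.inl i) : ℝ) : ℂ) + ((e j (Sum.inr i) : ℝ) : ℂ) * Complex.I := by
    funext e
    apply Complex.ext <;> simp [complexMatrix]
  rw [h]
  fun_prop

theorem complexMatrix_mem_unitaryGroup {e : Fin k → PhaseSpace k} (he : Orthonormal ℝ e)
    (hiso : IsIsotropic (Submodule.span ℝ (Set.range e))) :
    complexMatrix e ∈ Matrix.unitaryGroup (Fin k) ℂ := by
  rw [Matrix.mem_unitaryGroup_iff', Matrix.star_eq_conjTranspose]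
  ext j l
  rw [conjTranspose_mul_self_apply, unitaryFrame_complexMatrix,
    hiso _ (Submodule.subset_span ⟨j, rfl⟩) _ (Submodule.subset_span ⟨l, rfl⟩),
    orthonormal_iff_ite.1 he, Matrix.one_apply]
  split_ifs <;> simp

end Frames

/-! ## Determinants of frame matrices -/

section FrameMatrix

variable {p q : ℕ}

theorem frameMatrix_det_ne_zero {v : Fin p → EuclideanSpace ℝ (Fin p ⊕ Fin q)}
    {w : Fin q → EuclideanSpace ℝ (Fin p ⊕ Fin q)}
    (h : Transversal (Submodule.span ℝ (Set.range v)) (Submodule.span ℝ (Set.range w))) :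
    (frameMatrix v w).det ≠ 0 := by
  have hli : LinearIndependent ℝ (Sum.elim v w) := by
    refine linearIndependent_of_top_le_span_of_card_eq_finrank ?_ (by simp [finrank_euclideanSpace])
    rw [Set.Sum.elim_range, Submodule.span_union]
    exact (show _ ⊔ _ = ⊤ from h).ge
  have hcol : LinearIndependent ℝ (frameMatrix v w).col :=
    hli.map' (WithLp.linearEquiv 2 ℝ (Fin p ⊕ Fin q → ℝ)).toLinearMap (LinearEquiv.ker _)
  rw [Matrix.linearIndependent_cols_iff_isUnit, Matrix.isUnit_iff_isUnit_det] at hcol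
  exact hcol.ne_zero

/-- The matrix of scalar products of two families of vectors. -/
def innerMatrix {E : Type*} [NormedAddCommGroup E] [InnerProductSpace ℝ E]
    {m : ℕ} (e v : Fin m → E) : Matrix (Fin m) (Fin m) ℝ :=
  Matrix.of fun i j => inner ℝ (e i) (v j)

/-- Relative to an orthonormal frame the change-of-frame matrix consists of scalar products, so it
depends continuously on the two frames. -/
theorem eq_sum_innerMatrix {E : Type*} [NormedAddCommGroup E] [InnerProductSpace ℝ E]
    {m : ℕ} {e v : Fin m → E} (he : Orthonormal ℝ e)
    (h : Submodule.span ℝ (Set.range v) ≤ Submodule.span ℝ (Set.range e)) (j : Fin m) :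
    v j = ∑ i, innerMatrix e v i j • e i := by
  obtain ⟨c, hc⟩ := (Submodule.mem_span_range_iff_exists_fun ℝ).1
    (h (Submodule.subset_span ⟨j, rfl⟩))
  rw [← hc]
  refine Finset.sum_congr rfl fun i _ => ?_
  congr 1
  simp only [innerMatrix, Matrix.of_apply, ← hc]
  exact (he.inner_right_fintype c i).symm

theorem innerMatrix_det_ne_zero {E : Type*} [NormedAddCommGroup E] [InnerProductSpace ℝ E]
    {m : ℕ} {e v : Fin m → E} (he : Orthonormal ℝ e) (hv : LinearIndependent ℝ v)
    (h : Submodule.span ℝ (Set.range v) ≤ Submodule.span ℝ (Set.range e)) :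
    (innerMatrix e v).det ≠ 0 := by
  intro h0
  obtain ⟨c, hc0, hc⟩ := Matrix.exists_mulVec_eq_zero_iff.2 h0
  refine hc0 (funext (Fintype.linearIndependent_iff.1 hv c ?_))
  calc ∑ j, c j • v j = ∑ j, c j • ∑ i, innerMatrix e v i j • e i :=
        Finset.sum_congr rfl fun j _ => by rw [← eq_sum_innerMatrix he h j]
    _ = ∑ i, (innerMatrix e v).mulVec c i • e i := by
        simp only [Finset.smul_sum, Matrix.mulVec, dotProduct, Finset.sum_smul]
        rw [Finset.sum_comm]
        refine Finset.sum_congr rfl fun i _ => Finset.sum_congr rfl fun j _ => ?_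
        rw [smul_smul, mul_comm]
    _ = 0 := by simp [hc]

/-- Changing the two frames separately multiplies the frame matrix on the right by a block diagonal
matrix. -/
theorem frameMatrix_det_eq {v e : Fin p → EuclideanSpace ℝ (Fin p ⊕ Fin q)}
    {w f : Fin q → EuclideanSpace ℝ (Fin p ⊕ Fin q)} (he : Orthonormal ℝ e) (hf : Orthonormal ℝ f)
    (hve : Submodule.span ℝ (Set.range v) ≤ Submodule.span ℝ (Set.range e))
    (hwf : Submodule.span ℝ (Set.range w) ≤ Submodule.span ℝ (Set.range f)) :
    (frameMatrix v w).det =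
      (frameMatrix e f).det * ((innerMatrix e v).det * (innerMatrix f w).det) := by
  have h : frameMatrix v w =
      frameMatrix e f * Matrix.fromBlocks (innerMatrix e v) 0 0 (innerMatrix f w) := by
    ext i j
    rw [Matrix.mul_apply, Fintype.sum_sum_type]
    rcases j with j | j
    · simp only [frameMatrix, Matrix.of_apply, Sum.elim_inl, Sum.elim_inr,
        Matrix.fromBlocks_apply₁₁, Matrix.fromBlocks_apply₂₁, Matrix.zero_apply, mul_zero,
        Finset.sum_const_zero, add_zero]
      conv_lhs => rw [eq_sum_innerMatrix he hve j]
      simp [mul_comm]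
    · simp only [frameMatrix, Matrix.of_apply, Sum.elim_inl, Sum.elim_inr,
        Matrix.fromBlocks_apply₁₂, Matrix.fromBlocks_apply₂₂, Matrix.zero_apply, mul_zero,
        Finset.sum_const_zero, zero_add]
      conv_lhs => rw [eq_sum_innerMatrix hf hwf j]
      simp [mul_comm]
  rw [h, Matrix.det_mul, Matrix.det_fromBlocks_zero₂₁]

theorem mul_pos_of_continuousOn_ne_zero {f : ℝ → ℝ} {a b : ℝ} (hab : a ≤ b)
    (hf : ContinuousOn f (Set.Icc a b)) (h0 : ∀ t ∈ Set.Icc a b, f t ≠ 0) : 0 < f a * f b := by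
  by_contra hle
  have ha := h0 a (Set.left_mem_Icc.2 hab)
  have hb := h0 b (Set.right_mem_Icc.2 hab)
  have hlt : f a * f b < 0 := lt_of_le_of_ne (not_lt.1 hle) (mul_ne_zero ha hb)
  rcases mul_neg_iff.1 hlt with ⟨h1, h2⟩ | ⟨h1, h2⟩
  · obtain ⟨t, ht, h⟩ := intermediate_value_Icc' hab hf ⟨h2.le, h1.le⟩
    exact h0 t ht h
  · obtain ⟨t, ht, h⟩ := intermediate_value_Icc hab hf ⟨h1.le, h2.le⟩
    exact h0 t ht h

theorem continuousOn_innerMatrix_det {E : Type*} [NormedAddCommGroup E] [InnerProductSpace ℝ E]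
    {m : ℕ} {e v : ℝ → Fin m → E} {s : Set ℝ} (he : ContinuousOn e s) (hv : ContinuousOn v s) :
    ContinuousOn (fun t => (innerMatrix (e t) (v t)).det) s := by
  rw [continuousOn_iff_continuous_domRestrict] at *
  refine Continuous.matrix_det (continuous_matrix fun i j => ?_)
  exact ((continuous_apply i).comp he).inner ((continuous_apply j).comp hv)

/-- The sign of `det (M(a) M(b))` does not depend on the choice of the frames. -/
theorem exists_pos_frameMatrix_det_mul {V W : ℝ → Submodule ℝ (EuclideanSpace ℝ (Fin p ⊕ Fin q))}
    {a b : ℝ} (hab : a ≤ b) {v e : ℝ → Fin p → EuclideanSpace ℝ (Fin p ⊕ Fin q)}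
    {w f : ℝ → Fin q → EuclideanSpace ℝ (Fin p ⊕ Fin q)}
    (hv : IsContinuousFrame V a b v) (hw : IsContinuousFrame W a b w)
    (he : IsContinuousFrame V a b e) (hf : IsContinuousFrame W a b f)
    (heo : ∀ t, Orthonormal ℝ (e t)) (hfo : ∀ t, Orthonormal ℝ (f t)) :
    ∃ r > 0, (frameMatrix (v a) (w a)).det * (frameMatrix (v b) (w b)).det =
      r * ((frameMatrix (e a) (f a)).det * (frameMatrix (e b) (f b)).det) := by
  have hve : ∀ t ∈ Set.Icc a b,
      Submodule.span ℝ (Set.range (v t)) ≤ Submodule.span ℝ (Set.range (e t)) := fun t ht => by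
    rw [hv.span_eq t ht, he.span_eq t ht]
  have hwf : ∀ t ∈ Set.Icc a b,
      Submodule.span ℝ (Set.range (w t)) ≤ Submodule.span ℝ (Set.range (f t)) := fun t ht => by
    rw [hw.span_eq t ht, hf.span_eq t ht]
  -- Each change-of-frame determinant is continuous and nowhere zero on `[a, b]`, so its values at
  -- the two ends have the same sign.
  have h1 := mul_pos_of_continuousOn_ne_zero hab
    (continuousOn_innerMatrix_det he.continuousOn hv.continuousOn)
    fun t ht => innerMatrix_det_ne_zero (heo t) (hv.linearIndependent t ht) (hve t ht)
  have h2 := mul_pos_of_continuousOn_ne_zero hab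
    (continuousOn_innerMatrix_det hf.continuousOn hw.continuousOn)
    fun t ht => innerMatrix_det_ne_zero (hfo t) (hw.linearIndependent t ht) (hwf t ht)
  have ha := Set.left_mem_Icc.2 hab
  have hb := Set.right_mem_Icc.2 hab
  refine ⟨_, mul_pos h1 h2, ?_⟩
  rw [frameMatrix_det_eq (heo a) (hfo a) (hve a ha) (hwf a ha),
    frameMatrix_det_eq (heo b) (hfo b) (hve b hb) (hwf b hb)]
  ring

end FrameMatrix

/-! ## The determinant formula for unitary frames -/

section Angles

/-- The angle in `(0, 2π]` of a complex number. -/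
def angle (z : ℂ) : ℝ := toIocMod Real.two_pi_pos 0 z.arg

theorem exp_angle {z : ℂ} (hz : ‖z‖ = 1) : Complex.exp (angle z * Complex.I) = z := by
  have h1 : angle z = z.arg - toIocDiv Real.two_pi_pos 0 z.arg • (2 * Real.pi) := rfl
  rw [h1]
  push_cast
  rw [sub_mul, Complex.exp_sub]
  have h2 : Complex.exp (((toIocDiv Real.two_pi_pos 0 z.arg • (2 * Real.pi) : ℝ) : ℂ) * Complex.I)
      = 1 := by
    rw [Complex.exp_eq_one_iff]
    refine ⟨toIocDiv Real.two_pi_pos 0 z.arg, ?_⟩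
    push_cast [zsmul_eq_mul]
    ring
  have h3 := Complex.norm_mul_exp_arg_mul_I z
  rw [hz, Complex.ofReal_one, one_mul] at h3
  push_cast at h2
  rw [h2, div_one, h3]

theorem one_sub_exp (θ : ℝ) : 1 - Complex.exp (θ * Complex.I) =
    -2 * Complex.I * Complex.exp (θ / 2 * Complex.I) * (Real.sin (θ / 2) : ℝ) := by
  have h1 : Complex.exp (θ * Complex.I) = Complex.exp (θ / 2 * Complex.I) *
      Complex.exp (θ / 2 * Complex.I) := by
    rw [← Complex.exp_add]
    ring_nf
  have h2 : Complex.exp (θ / 2 * Complex.I) * Complex.exp (-(θ / 2 * Complex.I)) = 1 := by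
    rw [← Complex.exp_add]
    simp
  have h3 : Complex.exp (-(θ / 2 * Complex.I)) = Complex.exp (-(θ / 2) * Complex.I) := by
    ring_nf
  rw [Complex.ofReal_sin, Complex.sin]
  push_cast
  rw [h1]
  rw [h3] at h2
  linear_combination -h2 + (Complex.exp (θ / 2 * Complex.I) * Complex.exp (-(θ / 2) * Complex.I) -
    Complex.exp (θ / 2 * Complex.I) ^ 2) * Complex.I_sq

theorem exp_sum_angle (s : Multiset ℂ) (hs : ∀ z ∈ s, ‖z‖ = 1) :
    Complex.exp ((s.map angle).sum * Complex.I) = s.prod := by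
  induction s using Multiset.induction with
  | empty => simp
  | cons z s ih =>
    rw [Multiset.map_cons, Multiset.sum_cons, Multiset.prod_cons,
      ← ih fun w hw => hs w (Multiset.mem_cons_of_mem hw)]
    push_cast
    rw [add_mul, Complex.exp_add, exp_angle (hs z (Multiset.mem_cons_self z s))]

/-- By the half-angle formula each factor has phase `-i e^{iθ/2}` up to `sin (θ/2)`, which is
nonnegative precisely because the angles are taken in `(0, 2π]`. The sum of the angles thus fixes
the phase of the product. -/
theorem exists_prod_one_sub_eq (s : Multiset ℂ) (hs : ∀ z ∈ s, ‖z‖ = 1) :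
    ∃ r : ℝ, 0 ≤ r ∧ (s.map fun z => 1 - z).prod =
      (-2 * Complex.I) ^ s.card * Complex.exp ((s.map angle).sum / 2 * Complex.I) * r := by
  induction s using Multiset.induction with
  | empty => exact ⟨1, zero_le_one, by simp⟩
  | cons z s ih =>
    obtain ⟨r, hr, h⟩ := ih fun w hw => hs w (Multiset.mem_cons_of_mem hw)
    have hθ := toIocMod_mem_Ioc Real.two_pi_pos 0 z.arg
    rw [zero_add] at hθ
    refine ⟨Real.sin (angle z / 2) * r, mul_nonneg (Real.sin_nonneg_of_nonneg_of_le_pi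
      (by have := hθ.1; unfold angle; linarith) (by have := hθ.2; unfold angle; linarith)) hr, ?_⟩
    have h1 := one_sub_exp (angle z)
    rw [exp_angle (hs z (Multiset.mem_cons_self z s))] at h1
    rw [Multiset.map_cons, Multiset.prod_cons, h, h1, Multiset.map_cons, Multiset.sum_cons,
      Multiset.card_cons]
    push_cast
    rw [add_div, add_mul, Complex.exp_add, pow_succ]
    ring

end Angles

/-! ### Phase of the frame determinant and the Maslov index -/

section UnitaryDet

variable {k : ℕ}

open scoped Matrix.Norms.L2Operator in
theorem norm_eq_one_of_mem_charpoly_roots {U : Matrix (Fin k) (Fin k) ℂ}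
    (hU : U ∈ Matrix.unitaryGroup (Fin k) ℂ) {z : ℂ} (hz : z ∈ U.charpoly.roots) : ‖z‖ = 1 := by
  have h1 : z ∈ spectrum ℂ U := by
    rw [Matrix.mem_spectrum_iff_isRoot_charpoly]
    exact (Polynomial.mem_roots'.1 hz).2
  simpa using spectrum.subset_circle_of_unitary hU h1

theorem exp_angleSum {U : Matrix (Fin k) (Fin k) ℂ} (hU : U ∈ Matrix.unitaryGroup (Fin k) ℂ) :
    Complex.exp (angleSum U * Complex.I) = U.det := by
  rw [Matrix.det_eq_prod_roots_charpoly]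
  exact exp_sum_angle _ fun z hz => norm_eq_one_of_mem_charpoly_roots hU hz

theorem exists_det_one_sub_eq {U : Matrix (Fin k) (Fin k) ℂ}
    (hU : U ∈ Matrix.unitaryGroup (Fin k) ℂ) :
    ∃ r : ℝ, 0 ≤ r ∧ (1 - U).det =
      (-2 * Complex.I) ^ k * Complex.exp (angleSum U / 2 * Complex.I) * r := by
  obtain ⟨r, hr, h⟩ := exists_prod_one_sub_eq _
    fun z hz => norm_eq_one_of_mem_charpoly_roots hU hz
  have hsplit := IsAlgClosed.splits U.charpoly
  have hcard : U.charpoly.roots.card = k := by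
    rw [← hsplit.natDegree_eq_card_roots, Matrix.charpoly_natDegree_eq_dim, Fintype.card_fin]
  refine ⟨r, hr, ?_⟩
  rw [hcard] at h
  refine Eq.trans ?_ h
  have h1 : U.charpoly.eval 1 = (1 - U).det := by
    rw [Matrix.eval_charpoly]
    simp
  rw [← h1]
  conv_lhs => rw [hsplit.eq_prod_roots_of_monic U.charpoly_monic]
  rw [Polynomial.eval_multiset_prod, Multiset.map_map]
  simp

theorem transpose_mem_unitaryGroup {X : Matrix (Fin k) (Fin k) ℂ}
    (hX : X ∈ Matrix.unitaryGroup (Fin k) ℂ) : X.transpose ∈ Matrix.unitaryGroup (Fin k) ℂ := by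
  rw [Matrix.mem_unitaryGroup_iff', Matrix.star_eq_conjTranspose,
    show X.transpose.conjTranspose = X.conjTranspose.transpose from rfl, ← Matrix.transpose_mul,
    ← Matrix.star_eq_conjTranspose, (Matrix.mem_unitaryGroup_iff).1 hX, Matrix.transpose_one]

theorem conjTranspose_mul_mem_unitaryGroup {A B : Matrix (Fin k) (Fin k) ℂ}
    (hA : A ∈ Matrix.unitaryGroup (Fin k) ℂ) (hB : B ∈ Matrix.unitaryGroup (Fin k) ℂ) :
    A.conjTranspose * B ∈ Matrix.unitaryGroup (Fin k) ℂ :=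
  mul_mem (Unitary.star_mem hA) hB

theorem souriauMatrix_mem_unitaryGroup {A B : Matrix (Fin k) (Fin k) ℂ}
    (hA : A ∈ Matrix.unitaryGroup (Fin k) ℂ) (hB : B ∈ Matrix.unitaryGroup (Fin k) ℂ) :
    souriauMatrix A B ∈ Matrix.unitaryGroup (Fin k) ℂ :=
  mul_mem (transpose_mem_unitaryGroup (conjTranspose_mul_mem_unitaryGroup hA hB))
    (conjTranspose_mul_mem_unitaryGroup hA hB)

theorem det_souriauMatrix (A B : Matrix (Fin k) (Fin k) ℂ) :
    (souriauMatrix A B).det = (A.conjTranspose * B).det ^ 2 := by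
  rw [souriauMatrix, Matrix.det_mul, Matrix.det_transpose, sq]

/-- Multiplying the frame matrix on the left by `[[1, i], [1, -i]]`, of determinant `(-2i)^k`,
produces `[[A, B], [Ā, B̄]]`. From `B̄ = Ā X̄` and `X̄ Xᵀ = 1`, the Schur complement is `B̄ - Ā A⁻¹
B = Ā X̄ (1 - Xᵀ X)`, and `det A · det Ā = 1`. -/
theorem neg_two_I_pow_mul_frameMatrix_det {A B : Matrix (Fin k) (Fin k) ℂ}
    (hA : A ∈ Matrix.unitaryGroup (Fin k) ℂ) (hB : B ∈ Matrix.unitaryGroup (Fin k) ℂ) :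
    (-2 * Complex.I) ^ k * ((frameMatrix (unitaryFrame A) (unitaryFrame B)).det : ℂ) =
      star (A.conjTranspose * B).det * (1 - souriauMatrix A B).det := by
  set X := A.conjTranspose * B with hX
  set c := (starRingEnd ℂ) with hc
  have hXu : X ∈ Matrix.unitaryGroup (Fin k) ℂ := conjTranspose_mul_mem_unitaryGroup hA hB
  have hA1 : A.conjTranspose * A = 1 := (Matrix.mem_unitaryGroup_iff').1 hA
  have hA2 : A * A.conjTranspose = 1 := (Matrix.mem_unitaryGroup_iff).1 hA
  have hX2 : X * X.conjTranspose = 1 := (Matrix.mem_unitaryGroup_iff).1 hXu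
  have hM : (((frameMatrix (unitaryFrame A) (unitaryFrame B)).det : ℝ) : ℂ) =
      (Matrix.fromBlocks (A.map fun z => (z.re : ℂ)) (B.map fun z => (z.re : ℂ))
        (A.map fun z => (z.im : ℂ)) (B.map fun z => (z.im : ℂ))).det := by
    have h := RingHom.map_det Complex.ofRealHom (frameMatrix (unitaryFrame A) (unitaryFrame B))
    refine h.trans (congrArg Matrix.det ?_)
    ext i j
    rcases i with i | i <;> rcases j with j | j <;> rfl
  have hL : (Matrix.fromBlocks (1 : Matrix (Fin k) (Fin k) ℂ) 
      (Complex.I • (1 : Matrix (Fin k) (Fin k) ℂ)) (1 : Matrix (Fin k) (Fin k) ℂ)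
      (-Complex.I • (1 : Matrix (Fin k) (Fin k) ℂ))).det = (-2 * Complex.I) ^ k := by
    rw [Matrix.det_fromBlocks_one₁₁, one_mul, ← sub_smul, Matrix.det_smul, Matrix.det_one,
      Fintype.card_fin, mul_one]
    congr 1
    ring
  have hre : ∀ z : ℂ, (z.re : ℂ) + Complex.I * z.im = z := fun z => by
    rw [mul_comm]
    exact Complex.re_add_im z
  have hre' : ∀ z : ℂ, (z.re : ℂ) + -(Complex.I * z.im) = c z := fun z => by
    apply Complex.ext <;> simp [hc]
  have hLM : Matrix.fromBlocks (1 : Matrix (Fin k) (Fin k) ℂ)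
      (Complex.I • (1 : Matrix (Fin k) (Fin k) ℂ)) (1 : Matrix (Fin k) (Fin k) ℂ)
      (-Complex.I • (1 : Matrix (Fin k) (Fin k) ℂ)) *
      Matrix.fromBlocks (A.map fun z => (z.re : ℂ)) (B.map fun z => (z.re : ℂ))
        (A.map fun z => (z.im : ℂ)) (B.map fun z => (z.im : ℂ)) =
      Matrix.fromBlocks A B (A.map c) (B.map c) := by
    rw [Matrix.fromBlocks_multiply]
    congr 1 <;> ext i j <;> simp [hre, hre']
  let _ : Invertible A := ⟨A.conjTranspose, hA1, hA2⟩
  have hconj : A.map c * X.map c = B.map c := by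
    rw [← Matrix.map_mul, hX, ← Matrix.mul_assoc, hA2, Matrix.one_mul]
  have hXc : X.map c * X.transpose = 1 := by
    have h := congrArg Matrix.transpose hX2
    rw [Matrix.transpose_mul, Matrix.transpose_one] at h
    exact h
  have hfac : B.map c - A.map c * ⅟A * B = A.map c * (X.map c * (1 - souriauMatrix A B)) := by
    have h1 : ⅟A = A.conjTranspose := rfl
    rw [h1, Matrix.mul_assoc, ← hX, ← hconj, souriauMatrix, ← hX, Matrix.mul_sub, Matrix.mul_one,
      ← Matrix.mul_assoc (X.map c), hXc, Matrix.one_mul, Matrix.mul_sub]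
  have hdet : ∀ Y : Matrix (Fin k) (Fin k) ℂ, (Y.map c).det = star Y.det := fun Y =>
    (RingHom.map_det c Y).symm
  rw [hM, ← hL, ← Matrix.det_mul, hLM, Matrix.det_fromBlocks₁₁, hfac, Matrix.det_mul,
    Matrix.det_mul, hdet, hdet, ← mul_assoc]
  have hA3 : A.det * star A.det = 1 := by
    rw [← hdet A, ← Matrix.det_transpose (A.map c), ← Matrix.det_mul]
    exact (congrArg Matrix.det hA2).trans Matrix.det_one
  rw [hA3, one_mul]

theorem exists_frameMatrix_det_eq {A B : Matrix (Fin k) (Fin k) ℂ}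
    (hA : A ∈ Matrix.unitaryGroup (Fin k) ℂ) (hB : B ∈ Matrix.unitaryGroup (Fin k) ℂ) :
    ∃ r : ℝ, 0 ≤ r ∧ ((frameMatrix (unitaryFrame A) (unitaryFrame B)).det : ℂ) =
      star (A.conjTranspose * B).det *
        Complex.exp (angleSum (souriauMatrix A B) / 2 * Complex.I) * r := by
  obtain ⟨r, hr, h⟩ := exists_det_one_sub_eq (souriauMatrix_mem_unitaryGroup hA hB)
  refine ⟨r, hr, ?_⟩
  have h1 := neg_two_I_pow_mul_frameMatrix_det hA hB
  rw [h] at h1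
  have h2 : (-2 * Complex.I) ^ k ≠ 0 := pow_ne_zero _ (by simp)
  refine mul_left_cancel₀ h2 (h1.trans ?_)
  ring

theorem star_det_mul_det {X : Matrix (Fin k) (Fin k) ℂ} (hX : X ∈ Matrix.unitaryGroup (Fin k) ℂ) :
    star X.det * X.det = 1 := by
  rw [← Matrix.det_conjTranspose, ← Matrix.det_mul]
  exact (congrArg Matrix.det ((Matrix.mem_unitaryGroup_iff').1 hX)).trans Matrix.det_one

/-- The parity of the Maslov index is the sign of `det (M(a) M(b))`. -/
theorem exists_neg_one_zpow_mul {A B : ℝ → Matrix (Fin k) (Fin k) ℂ} {φ : ℝ → ℝ} {a b : ℝ}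
    (hab : a ≤ b) (hAc : ContinuousOn A (Set.Icc a b)) (hBc : ContinuousOn B (Set.Icc a b))
    (hφ : ContinuousOn φ (Set.Icc a b))
    (hA : ∀ t ∈ Set.Icc a b, A t ∈ Matrix.unitaryGroup (Fin k) ℂ)
    (hB : ∀ t ∈ Set.Icc a b, B t ∈ Matrix.unitaryGroup (Fin k) ℂ)
    (hdet : ∀ t ∈ Set.Icc a b,
      (souriauMatrix (A t) (B t)).det = Complex.exp (φ t * Complex.I)) {m : ℤ}
    (hm : (φ b - angleSum (souriauMatrix (A b) (B b))) -
      (φ a - angleSum (souriauMatrix (A a) (B a))) = 2 * Real.pi * m) :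
    ∃ r : ℝ, 0 ≤ r ∧ (frameMatrix (unitaryFrame (A a)) (unitaryFrame (B a))).det *
      (frameMatrix (unitaryFrame (A b)) (unitaryFrame (B b))).det = (-1) ^ m * r := by
  -- Since `(det X)² = det U = e^{iφ}` and `|det X| = 1`, this function takes values `±1`; being
  -- continuous on `[a, b]`, it is constant, so its square drops out of the product of the two
  -- determinants.
  set ε : ℝ → ℂ := fun t =>
    star ((A t).conjTranspose * B t).det * Complex.exp (φ t / 2 * Complex.I) with hε
  have ha := Set.left_mem_Icc.2 hab
  have hb := Set.right_mem_Icc.2 hab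
  have hεc : ContinuousOn ε (Set.Icc a b) := by
    rw [continuousOn_iff_continuous_domRestrict] at *
    have h1 : Continuous fun t : Set.Icc a b => ((A t).conjTranspose * B t).det :=
      (hAc.matrix_conjTranspose.matrix_mul hBc).matrix_det
    have h2 : Continuous fun t : Set.Icc a b => Complex.exp (φ t / 2 * Complex.I) := by
      have h3 : Continuous fun t : Set.Icc a b => (φ t : ℂ) := Complex.continuous_ofReal.comp hφ
      fun_prop
    exact h1.star.mul h2
  have hsq : ∀ t ∈ Set.Icc a b, ε t ^ 2 = 1 := fun t ht => by
    have h1 := star_det_mul_det (conjTranspose_mul_mem_unitaryGroup (hA t ht) (hB t ht))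
    have h2 := hdet t ht
    rw [det_souriauMatrix] at h2
    have h3 : Complex.exp (φ t / 2 * Complex.I) ^ 2 = Complex.exp (φ t * Complex.I) := by
      rw [← Complex.exp_nat_mul]
      congr 1
      push_cast
      ring
    simp only [hε]
    rw [mul_pow, h3, ← h2, ← mul_pow, h1, one_pow]
  have hconst : ε a = ε b := by
    have h := isPreconnected_Icc.eq_or_eq_neg_of_sq_eq (f := ε) (g := fun _ => 1) hεc
      continuousOn_const (fun t ht => by simp [hsq t ht]) (fun _ => one_ne_zero)
    rcases h with h | h
    · rw [h ha, h hb]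
    · rw [h ha, h hb]
      simp
  obtain ⟨ra, hra, hda⟩ := exists_frameMatrix_det_eq (hA a ha) (hB a ha)
  obtain ⟨rb, hrb, hdb⟩ := exists_frameMatrix_det_eq (hA b hb) (hB b hb)
  set θa := angleSum (souriauMatrix (A a) (B a)) with hθa
  set θb := angleSum (souriauMatrix (A b) (B b)) with hθb
  have hexp : ∀ t, star ((A t).conjTranspose * B t).det =
      ε t * Complex.exp (-(φ t / 2 * Complex.I)) := fun t => by
    simp only [hε]
    rw [mul_assoc, ← Complex.exp_add, add_neg_cancel, Complex.exp_zero, mul_one]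
  have hea : Complex.exp (θa * Complex.I) = Complex.exp (φ a * Complex.I) := by
    rw [hθa, exp_angleSum (souriauMatrix_mem_unitaryGroup (hA a ha) (hB a ha)), hdet a ha]
  refine ⟨ra * rb, mul_nonneg hra hrb, ?_⟩
  have hprod : (((frameMatrix (unitaryFrame (A a)) (unitaryFrame (B a))).det *
      (frameMatrix (unitaryFrame (A b)) (unitaryFrame (B b))).det : ℝ) : ℂ) =
      (((-1) ^ m * (ra * rb) : ℝ) : ℂ) := by
    push_cast
    rw [hda, hdb, hexp, hexp, ← hconst]
    -- Substituting for `φ b` turns the half-phases into `e^{i(θa - φ a)} e^{-iπm}`. The first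
    -- factor is `1` because `θa` and `φ a` are arguments of the same determinant.
    have hphase : Complex.exp (-(φ a / 2 * Complex.I)) * Complex.exp (θa / 2 * Complex.I) *
        (Complex.exp (-(φ b / 2 * Complex.I)) * Complex.exp (θb / 2 * Complex.I)) =
        (-1 : ℂ) ^ m := by
      have h1 : (φ b : ℂ) = θb + φ a - θa + 2 * Real.pi * m := by
        have : φ b = θb + φ a - θa + 2 * Real.pi * m := by linarith
        rw [this]
        push_cast
        ring
      have h2 : Complex.exp (-(Real.pi * Complex.I)) = -1 := by
        rw [Complex.exp_neg, Complex.exp_pi_mul_I]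
        norm_num
      rw [← Complex.exp_add, ← Complex.exp_add, ← Complex.exp_add, h1, ← h2, ← Complex.exp_int_mul]
      have h3 : -(φ a / 2 * Complex.I) + θa / 2 * Complex.I +
          (-((θb + φ a - θa + 2 * Real.pi * m) / 2 * Complex.I) + θb / 2 * Complex.I) =
          (θa * Complex.I - φ a * Complex.I) + m * -(Real.pi * Complex.I) := by ring
      rw [h3, Complex.exp_add, Complex.exp_sub, hea, div_self (Complex.exp_ne_zero _), one_mul]
    have h5 := hsq a ha
    linear_combination (ra * rb * ε a ^ 2) * hphase + (ra * rb * (-1 : ℂ) ^ m) * h5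
  exact_mod_cast hprod

end UnitaryDet

/-! ## Comparison of the two indices -/

section Comparison

variable {k : ℕ}

theorem isSimplyConnected_univ_real : IsSimplyConnected (Set.univ : Set ℝ) := by
  have : ContractibleSpace (Set.univ : Set ℝ) :=
    convex_univ.contractibleSpace Set.univ_nonempty
  exact SimplyConnectedSpace.ofContractible _

/-- A continuous argument of the determinant of a continuous path of unitary matrices. -/
theorem exists_continuous_arg {U : ℝ → Matrix (Fin k) (Fin k) ℂ} (hU : Continuous U)
    (hu : ∀ t, U t ∈ Matrix.unitaryGroup (Fin k) ℂ) :
    ∃ φ : ℝ → ℝ, Continuous φ ∧ ∀ t, (U t).det = Complex.exp (φ t * Complex.I) := by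
  obtain ⟨f, hf, hfe⟩ := Complex.exists_continuousOn_eqOn_exp_comp (X := ℝ) (U := Set.univ)
    (g := fun t => (U t).det) isSimplyConnected_univ_real isOpen_univ hU.matrix_det.continuousOn (by
      rintro ⟨t, -, ht⟩
      have := star_det_mul_det (hu t)
      simp only at ht
      rw [ht] at this
      simp at this)
  rw [continuousOn_univ] at hf
  refine ⟨fun t => (f t).im, Complex.continuous_im.comp hf, fun t => ?_⟩
  have h1 : Complex.exp (f t) = (U t).det := hfe (Set.mem_univ t)
  -- The determinant has modulus `1`, so its continuous logarithm `f` is purely imaginary.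
  have h2 : (f t).re = 0 := by
    have h3 := congrArg norm (star_det_mul_det (hu t))
    rw [norm_mul, norm_star, norm_one, ← h1, Complex.norm_exp] at h3
    rw [← Real.exp_add, Real.exp_eq_one_iff] at h3
    linarith
  rw [← h1]
  congr 1
  apply Complex.ext <;> simp [h2]

end Comparison

/-! ### Existence of the indices and equality of their parities -/

section MainTheorem

variable {k : ℕ}

theorem IsContinuousFrame.of_orthonormal {E : Type*} [NormedAddCommGroup E]
    [InnerProductSpace ℝ E] {m : ℕ} {V : ℝ → Submodule ℝ E} {e : ℝ → Fin m → E}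
    (hc : Continuous e) (ho : ∀ t, Orthonormal ℝ (e t))
    (hs : ∀ t, Submodule.span ℝ (Set.range (e t)) = V t) (a b : ℝ) : IsContinuousFrame V a b e :=
  ⟨hc.continuousOn, fun t _ => (ho t).linearIndependent, fun t _ => hs t⟩

theorem isContinuousFrame_unitaryFrame {V : ℝ → Submodule ℝ (PhaseSpace k)}
    {A : ℝ → Matrix (Fin k) (Fin k) ℂ} {a b : ℝ} (hA : ContinuousOn A (Set.Icc a b))
    (hu : ∀ t ∈ Set.Icc a b, A t ∈ Matrix.unitaryGroup (Fin k) ℂ)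
    (hV : ∀ t ∈ Set.Icc a b, lagrangianOf (A t) = V t) :
    IsContinuousFrame V a b fun t => unitaryFrame (A t) :=
  ⟨continuous_unitaryFrame.comp_continuousOn hA,
    fun t ht => (orthonormal_unitaryFrame (hu t ht)).linearIndependent, hV⟩

section Paths

variable {V W : ℝ → Submodule ℝ (PhaseSpace k)} {e f : ℝ → Fin k → PhaseSpace k}

theorem IsZ2Index.sign_of_orthonormal {a b : ℝ} (hab : a ≤ b) {i : ℤ} (h : IsZ2Index V W a b i)
    (he : IsContinuousFrame V a b e) (hf : IsContinuousFrame W a b f)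
    (heo : ∀ t, Orthonormal ℝ (e t)) (hfo : ∀ t, Orthonormal ℝ (f t)) :
    (0 < (frameMatrix (e a) (f a)).det * (frameMatrix (e b) (f b)).det ∧ i = 0) ∨
      ((frameMatrix (e a) (f a)).det * (frameMatrix (e b) (f b)).det < 0 ∧ i = 1) := by
  obtain ⟨v, w, hv, hw, h⟩ := h
  obtain ⟨r, hr, h1⟩ := exists_pos_frameMatrix_det_mul hab hv hw he hf heo hfo
  rw [Matrix.det_mul, h1] at h
  rcases h with ⟨h, rfl⟩ | ⟨h, rfl⟩
  · exact Or.inl ⟨(mul_pos_iff_of_pos_left hr).1 h, rfl⟩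
  · exact Or.inr ⟨neg_of_mul_neg_right h hr.le, rfl⟩

/-- The unitary frames in the definition may be replaced by any fixed orthonormal ones at the cost
of a positive factor. The inequality is not strict because transversality at the ends is not assumed
here. -/
theorem IsMaslovIndex.sign_of_orthonormal {a b : ℝ} (hab : a ≤ b) {m : ℤ}
    (h : IsMaslovIndex V W a b m)
    (he : IsContinuousFrame V a b e) (hf : IsContinuousFrame W a b f)
    (heo : ∀ t, Orthonormal ℝ (e t)) (hfo : ∀ t, Orthonormal ℝ (f t)) :
    0 ≤ (-1) ^ m * ((frameMatrix (e a) (f a)).det * (frameMatrix (e b) (f b)).det) := by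
  obtain ⟨A, B, φ, hA, hB, hφ, hAB, hm⟩ := h
  obtain ⟨r, hr, h1⟩ := exists_pos_frameMatrix_det_mul hab
    (isContinuousFrame_unitaryFrame hA (fun t ht => (hAB t ht).1) fun t ht => (hAB t ht).2.2.1)
    (isContinuousFrame_unitaryFrame hB (fun t ht => (hAB t ht).2.1) fun t ht => (hAB t ht).2.2.2.1)
    he hf heo hfo
  obtain ⟨s, hs, h2⟩ := exists_neg_one_zpow_mul hab hA hB hφ (fun t ht => (hAB t ht).1)
    (fun t ht => (hAB t ht).2.1) (fun t ht => (hAB t ht).2.2.2.2) hm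
  rw [h1] at h2
  have h3 : ((-1 : ℝ) ^ m) * (-1) ^ m = 1 := by
    rw [← mul_zpow]
    simp
  refine (mul_nonneg_iff_of_pos_left hr).1 ?_
  have h4 : r * ((-1) ^ m * ((frameMatrix (e a) (f a)).det * (frameMatrix (e b) (f b)).det)) =
      s := by
    linear_combination (-1 : ℝ) ^ m * h2 + s * h3
  rw [h4]
  exact hs

/-- The two indices on a half-line have the same parity. -/
theorem IsZ2IndexOnIci.modEq {a : ℝ} (hec : Continuous e) (hfc : Continuous f)
    (heo : ∀ t, Orthonormal ℝ (e t)) (hfo : ∀ t, Orthonormal ℝ (f t))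
    (hes : ∀ t, Submodule.span ℝ (Set.range (e t)) = V t)
    (hfs : ∀ t, Submodule.span ℝ (Set.range (f t)) = W t)
    {i m : ℤ} (hi : IsZ2IndexOnIci V W a i) (hm : IsMaslovIndexOnIci V W a m) :
    i ≡ m [ZMOD 2] := by
  obtain ⟨T₁, hT₁, htr₁, h₁⟩ := hi
  obtain ⟨T₂, hT₂, htr₂, h₂⟩ := hm
  have he := IsContinuousFrame.of_orthonormal hec heo hes
  have hf := IsContinuousFrame.of_orthonormal hfc hfo hfs
  have s₁ := h₁.sign_of_orthonormal hT₁.le (he _ _) (hf _ _) heo hfo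
  have s₂ := h₂.sign_of_orthonormal hT₂.le (he _ _) (hf _ _) heo hfo
  set d : ℝ → ℝ := fun t => (frameMatrix (e t) (f t)).det with hd
  have hdc : Continuous d := by
    refine Continuous.matrix_det (continuous_matrix fun i j => ?_)
    rcases j with j | j
    · exact (PiLp.continuous_apply 2 _ i).comp ((continuous_apply j).comp hec)
    · exact (PiLp.continuous_apply 2 _ i).comp ((continuous_apply j).comp hfc)
  have hd0 : ∀ t, Transversal (V t) (W t) → d t ≠ 0 := fun t ht =>
    frameMatrix_det_ne_zero (by rw [hes, hfs]; exact ht)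
  -- The two indices may use different times; `d` has no zero between `T₁` and `T₂`, so its sign is
  -- the same at both.
  have h12 : 0 < d T₁ * d T₂ := by
    rcases le_total T₁ T₂ with h | h
    · exact mul_pos_of_continuousOn_ne_zero h hdc.continuousOn fun t ht => hd0 t (htr₁ t ht.1)
    · rw [mul_comm]
      exact mul_pos_of_continuousOn_ne_zero h hdc.continuousOn fun t ht => hd0 t (htr₂ t ht.1)
  change 0 ≤ (-1) ^ m * (d a * d T₂) at s₂
  change (0 < d a * d T₁ ∧ i = 0) ∨ (d a * d T₁ < 0 ∧ i = 1) at s₁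
  rcases s₁ with ⟨h, rfl⟩ | ⟨h, rfl⟩
  · have h3 : 0 < d a * d T₂ := by
      have h4 : 0 < (d a * d T₂) * (d T₁ * d T₁) := by
        have := mul_pos h h12
        linarith
      exact (mul_pos_iff_of_pos_right (mul_self_pos.2 (hd0 T₁ (htr₁ T₁ le_rfl)))).1 h4
    rcases Int.even_or_odd m with hm | hm
    · exact ((Int.even_iff.1 hm).symm : (0 : ℤ) % 2 = m % 2)
    · rw [hm.neg_one_zpow] at s₂
      linarith
  · have h3 : d a * d T₂ < 0 := by
      have h4 : (d a * d T₂) * (d T₁ * d T₁) < 0 := by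
        have := mul_neg_of_neg_of_pos h h12
        linarith
      exact neg_of_mul_neg_left h4 (mul_self_nonneg _)
    rcases Int.even_or_odd m with hm | hm
    · rw [hm.neg_one_zpow] at s₂
      linarith
    · exact ((Int.odd_iff.1 hm).symm : (1 : ℤ) % 2 = m % 2)

theorem exists_isZ2Index (he : ∀ a b, IsContinuousFrame V a b e)
    (hf : ∀ a b, IsContinuousFrame W a b f) {a b : ℝ} (hab : a ≤ b)
    (ha : Transversal (V a) (W a)) (hb : Transversal (V b) (W b)) :
    ∃ i, IsZ2Index V W a b i := by
  have hda : (frameMatrix (e a) (f a)).det ≠ 0 := frameMatrix_det_ne_zero (by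
    rw [(he a b).span_eq a ⟨le_rfl, hab⟩, (hf a b).span_eq a ⟨le_rfl, hab⟩]; exact ha)
  have hdb : (frameMatrix (e b) (f b)).det ≠ 0 := frameMatrix_det_ne_zero (by
    rw [(he a b).span_eq b ⟨hab, le_rfl⟩, (hf a b).span_eq b ⟨hab, le_rfl⟩]; exact hb)
  rcases lt_or_gt_of_ne (mul_ne_zero hda hdb) with h | h
  · exact ⟨1, e, f, he a b, hf a b, Or.inr ⟨by rwa [Matrix.det_mul], rfl⟩⟩
  · exact ⟨0, e, f, he a b, hf a b, Or.inl ⟨by rwa [Matrix.det_mul], rfl⟩⟩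

theorem exists_isMaslovIndex {A B : ℝ → Matrix (Fin k) (Fin k) ℂ} (hA : Continuous A)
    (hB : Continuous B) (hAu : ∀ t, A t ∈ Matrix.unitaryGroup (Fin k) ℂ)
    (hBu : ∀ t, B t ∈ Matrix.unitaryGroup (Fin k) ℂ) (hAV : ∀ t, lagrangianOf (A t) = V t)
    (hBW : ∀ t, lagrangianOf (B t) = W t) (a b : ℝ) :
    ∃ m, IsMaslovIndex V W a b m := by
  have hUu := fun t => souriauMatrix_mem_unitaryGroup (hAu t) (hBu t)
  have hX : Continuous fun t => (A t).conjTranspose * B t := hA.matrix_conjTranspose.matrix_mul hB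
  obtain ⟨φ, hφ, hdet⟩ := exists_continuous_arg (U := fun t => souriauMatrix (A t) (B t))
    (hX.matrix_transpose.matrix_mul hX) hUu
  -- `φ` and the angle sum are two arguments of `det U`, so they differ by a multiple of `2π` at
  -- every time, and the total change is an integer multiple as well.
  have hint : ∀ t, ∃ n : ℤ, φ t - angleSum (souriauMatrix (A t) (B t)) = 2 * Real.pi * n := by
    intro t
    have h1 := (exp_angleSum (hUu t)).trans (hdet t)
    obtain ⟨n, hn⟩ := Complex.exp_eq_exp_iff_exists_int.1 h1.symm
    refine ⟨n, ?_⟩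
    have h2 : (φ t : ℂ) * Complex.I =
        ((angleSum (souriauMatrix (A t) (B t)) + n * (2 * Real.pi) : ℝ) : ℂ) * Complex.I := by
      rw [hn]
      push_cast
      ring
    have h3 := Complex.ofReal_injective (mul_right_cancel₀ Complex.I_ne_zero h2)
    linarith
  obtain ⟨na, hna⟩ := hint a
  obtain ⟨nb, hnb⟩ := hint b
  refine ⟨nb - na, A, B, φ, hA.continuousOn, hB.continuousOn, hφ.continuousOn,
    fun t _ => ⟨hAu t, hBu t, hAV t, hBW t, hdet t⟩, ?_⟩
  rw [hna, hnb]
  push_cast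
  ring

end Paths

/-- The comparison of the two indices for linear Hamiltonian paths with hyperbolic limits. -/
theorem geometricalParity_modEq_maslovIndex {S : ℝ → PhaseSpace k →L[ℝ] PhaseSpace k}
    (hS : Continuous S)
    (hsymp : ∀ t, IsInfinitesimallySymplectic (S t : PhaseSpace k →ₗ[ℝ] PhaseSpace k))
    {Sm Sp : PhaseSpace k →L[ℝ] PhaseSpace k}
    (hSm : Tendsto S atBot (𝓝 Sm)) (hSp : Tendsto S atTop (𝓝 Sp))
    (hypm : IsHyperbolic (Sm : PhaseSpace k →ₗ[ℝ] PhaseSpace k))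
    (hypp : IsHyperbolic (Sp : PhaseSpace k →ₗ[ℝ] PhaseSpace k))
    (htrans : Transversal (posSpectralSubspace (Sm : PhaseSpace k →ₗ[ℝ] PhaseSpace k))
      (negSpectralSubspace (Sp : PhaseSpace k →ₗ[ℝ] PhaseSpace k)))
    (hnondeg : Transversal (stableSubspace S 0) (unstableSubspace S 0)) :
    (∃ i, IsGeometricalParity S i) ∧ (∃ m, IsMaslovIndexOfPath S m) ∧
      ∀ i m : ℤ, IsGeometricalParity S i → IsMaslovIndexOfPath S m → i ≡ m [ZMOD 2] := by
  have hisos : ∀ t, IsIsotropic (stableSubspace S t) := isIsotropic_decayingSubspace hsymp atTop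
  have hisou : ∀ t, IsIsotropic (unstableSubspace S t) := isIsotropic_decayingSubspace hsymp atBot
  -- Isotropic subspaces have dimension at most `k`, so transversality at time `0` makes both spaces
  -- Lagrangian; the frames below carry the dimension to all times.
  obtain ⟨hks, hku, -⟩ := hnondeg.of_isIsotropic (hisos 0) (hisou 0)
  obtain ⟨v, hvc, hvli, hvs⟩ := exists_frame_decayingSubspace hS hks
  obtain ⟨w, hwc, hwli, hws⟩ := exists_frame_decayingSubspace hS hku
  have hfs : ∀ t, Module.finrank ℝ (stableSubspace S t) = k := fun t => by
    have h := finrank_span_eq_card (hvli t)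
    rw [hvs t, Fintype.card_fin] at h
    exact h
  have hfu : ∀ t, Module.finrank ℝ (unstableSubspace S t) = k := fun t => by
    have h := finrank_span_eq_card (hwli t)
    rw [hws t, Fintype.card_fin] at h
    exact h
  obtain ⟨e, hec, heo, hes⟩ := exists_orthonormal_frame hvc hvli
  obtain ⟨f, hfc, hfo, hfs'⟩ := exists_orthonormal_frame (v := fun t => w (-t))
    (hwc.comp continuous_neg) fun t => hwli (-t)
  have heV : ∀ t, Submodule.span ℝ (Set.range (e t)) = stableSubspace S t := fun t =>
    (hes t).trans (hvs t)
  have hfW : ∀ t, Submodule.span ℝ (Set.range (f t)) = unstableSubspace S (-t) := fun t =>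
    (hfs' t).trans (hws (-t))
  obtain ⟨T, hT, htr⟩ := exists_forall_transversal hSm hSp
    (IsInfinitesimallySymplectic.of_tendsto hsymp hSm)
    (IsInfinitesimallySymplectic.of_tendsto hsymp hSp) hypm hypp htrans hfs hfu
  refine ⟨?_, ?_, fun i m hi hm => ?_⟩
  · obtain ⟨i, hi⟩ := exists_isZ2Index (IsContinuousFrame.of_orthonormal hec heo heV)
      (IsContinuousFrame.of_orthonormal hfc hfo hfW) hT.le (by simpa using hnondeg) (htr T le_rfl)
    exact ⟨i, T, hT, htr, hi⟩
  · obtain ⟨m, hm⟩ := exists_isMaslovIndex (V := stableSubspace S)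
      (W := fun t => unstableSubspace S (-t)) (continuous_complexMatrix.comp hec)
      (continuous_complexMatrix.comp hfc)
      (fun t => complexMatrix_mem_unitaryGroup (heo t) (by rw [heV]; exact hisos t))
      (fun t => complexMatrix_mem_unitaryGroup (hfo t) (by rw [hfW]; exact hisou (-t)))
      (fun t => by
        rw [← span_unitaryFrame, Function.comp_apply, unitaryFrame_complexMatrix, heV])
      (fun t => by
        rw [← span_unitaryFrame, Function.comp_apply, unitaryFrame_complexMatrix, hfW]) 0 T
    exact ⟨m, T, hT, htr, hm⟩
  · exact IsZ2IndexOnIci.modEq hec hfc heo hfo heV hfW hi hm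

end MainTheorem

end

theorem mainTheorem7 (k : ℕ) (H : ℝ → PhaseSpace k → ℝ)
    (hH : ∀ t, ContDiff ℝ 2 (H t))
    (hDg : Continuous fun y : ℝ × PhaseSpace k => fderiv ℝ (hamiltonianField H y.1) y.2)
    (zm zp : PhaseSpace k)
    (hzm : IsRestPoint (hamiltonianField H) zm) (hzp : IsRestPoint (hamiltonianField H) zp)
    (x : ℝ → PhaseSpace k) (hx : IsHeteroclinic (hamiltonianField H) zm zp x)
    (Sm Sp : PhaseSpace k →L[ℝ] PhaseSpace k)
    (hSm : Tendsto (linearizationAlong (hamiltonianField H) x) atBot (𝓝 Sm))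
    (hSp : Tendsto (linearizationAlong (hamiltonianField H) x) atTop (𝓝 Sp))
    (hypm : IsHyperbolic (Sm : PhaseSpace k →ₗ[ℝ] PhaseSpace k))
    (hypp : IsHyperbolic (Sp : PhaseSpace k →ₗ[ℝ] PhaseSpace k))
    (htrans : Transversal (posSpectralSubspace (Sm : PhaseSpace k →ₗ[ℝ] PhaseSpace k))
      (negSpectralSubspace (Sp : PhaseSpace k →ₗ[ℝ] PhaseSpace k)))
    (hnondeg : Transversal (stableSubspace (linearizationAlong (hamiltonianField H) x) 0)
      (unstableSubspace (linearizationAlong (hamiltonianField H) x) 0)) :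
    (∃ i, IsGeometricalParity (linearizationAlong (hamiltonianField H) x) i) ∧
    (∃ m, IsMaslovIndexOfPath (linearizationAlong (hamiltonianField H) x) m) ∧
    ∀ i m : ℤ, IsGeometricalParity (linearizationAlong (hamiltonianField H) x) i →
      IsMaslovIndexOfPath (linearizationAlong (hamiltonianField H) x) m → i ≡ m [ZMOD 2] := by
  have hxc : Continuous x := continuous_iff_continuousAt.2 fun t => (hx.hasDerivAt t).continuousAt
  have hS : Continuous (linearizationAlong (hamiltonianField H) x) :=
    hDg.comp (f := fun t => (t, x t)) (continuous_id.prodMk hxc)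
  exact geometricalParity_modEq_maslovIndex hS
    (fun t => isInfinitesimallySymplectic_fderiv_hamiltonianField (hH t) (x t))
    hSm hSp hypm hypp htrans hnondeg
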